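/- Let $(s)_n=s(s+1)\cdots(s+n-1)$ and let ${}_1F_1[s;t;z]=\sum_{n\ge0}\frac{(s)_n}{(t)_n}\frac{z^n}{n!}$, and let ${}_2F_1$ denote the Gauss hypergeometric series. Let $a,b,c,c'\in\mathbb C$ with $c,c'\notin\mathbb Z_{\le0}$ and $a-b\notin\mathbb Z$. Powers are principal. The Humbert function $$\Psi_1(x,y)=\Psi_1[a,b;c,c';x,y]=\sum_{m,n\ge0}\frac{(a)_{m+n}(b)_m}{(c)_m(c')_n}\frac{x^m}{m!}\frac{y^n}{n!}\qquad(|x|<1,\ y\in\mathbb C)$$ has an analytic continuation, again denoted $\Psi_1$, to $\{(x,y)\in\mathbb C^2: x\neq1,\ |\arg(1-x)|<\pi\}$. Put $$\mathfrak f_\gamma(\alpha,\beta)=\frac{\Gamma(\gamma)\Gamma(\alpha-\beta)}{\Gamma(\alpha)\Gamma(\gamma-\beta)},\qquad A=\mathfrak f_c(b,a),\quad B=\mathfrak f_c(a,b)$$ (with $1/\Gamma=0$ at the poles of $\Gamma$) and, for $|x|>1$ and $y\in\mathbb C$, $$\mathbf U_1(x,y)=\sum_{n\ge0}\frac{(a)_n}{n!(c')_n}\frac{(1-c+a)_n}{(1-b+a)_n}\,{}_2F_1\!\left[{1-c+a+n,\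 a+n\atop 1-b+a+n};\frac1x\right]\left(-\frac yx\right)^n,$$ $$\mathbf U_2(x,y)=\sum_{n\ge0}\frac{(a-b)_n}{n!(c')_n}\,{}_2F_1\!\left[{1-c+b,\ b\atop 1-a-n+b};\frac1x\right]y^n .$$ (1) For $|x|>1$ and $y\in\mathbb C$ these series converge absolutely, and $$\mathbf U_1(x,y)=\sum_{k\ge0}u_k\,x^{-k},\qquad u_k={}_1F_1[-k;c';y]\,\frac{(a)_k(1-c+a)_k}{(1-b+a)_k\,k!},$$ $$\mathbf U_2(x,y)=\sum_{\ell\ge0}v_\ell\,x^{-\ell},\qquad v_\ell={}_1F_1[a-b-\ell;c';y]\,\frac{(1-c+b)_\ell(b)_\ell}{(1-a+b)_\ell\,\ell!},$$ with absolute convergence. (2) For $|x|>1$, $|\arg(-x)|<\pi$ and $y\in\mathbb C$, $$\Psi_1(x,y)=A(-x)^{-a}\,\mathbf U_1(x,y)+B(-x)^{-b}\,\mathbf U_2(x,y).$$ (3) For fixed $y\in\mathbb C$ and $M,N\ge0$, as $|x|\to\infty$ in the sector $|\arg(-x)|<\pi$, $$\Psi_1(x,y)=A(-x)^{-a}\sum_{k<M}u_kx^{-k}+B(-x)^{-b}\sum_{\ell<N}v_\ell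 x^{-\ell}+O\!\left(|A|\,|x|^{-\Re a-M}+|B|\,|x|^{-\Re b-N}\right).$$ In particular, with $g(x)=A(-x)^{-a}+B(-x)^{-b}\,{}_1F_1[a-b;c';y]$ and $e(x)=|A|\,|x|^{-\Re a-1}+|B|\,|x|^{-\Re b-1}$, one has $\Psi_1(x,y)=g(x)+O(e(x))$. (4) Consequently $\Psi_1(x,y)\sim g(x)$, i.e. $\Psi_1(x,y)=g(x)(1+o(1))$, as $|x|\to\infty$ within any subset of the sector $|\arg(-x)|<\pi$ on which $e(x)=o(g(x))$. This holds in the whole sector if $\Re a<\Re b$ and $A\ne0$; if $\Re b<\Re a$ and $B\,{}_1F_1[a-b;c';y]\neq0$; if $B=0$ and $A\neq0$; and if $A=0$ and $B\,{}_1F_1[a-b;c';y]\ne0$. -/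

import Mathlib

open Filter Asymptotics Bornology
open scoped Nat

namespace Humbert

/-- Pochhammer symbol `(a)ₙ = a (a + 1) ⋯ (a + n - 1)`. -/
noncomputable def poch (a : ℂ) (n : ℕ) : ℂ := (ascPochhammer ℂ n).eval a

/-- Kummer's confluent hypergeometric function `₁F₁[a; c; z]`. -/
noncomputable def kummer (a c z : ℂ) : ℂ :=
  ∑' n : ℕ, poch a n / poch c n * (z ^ n / n !)

/-- The term of index `p = (m, n)` of the double series of `Ψ₁[a, b; c, c'; x, y]`. -/
noncomputable def psiTerm (a b c c' x y : ℂ) (p : ℕ × ℕ) : ℂ :=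
  poch a (p.1 + p.2) * poch b p.1 / (poch c p.1 * poch c' p.2) *
    (x ^ p.1 / p.1 !) * (y ^ p.2 / p.2 !)

/-- The domain `x ≠ 1`, `|arg (1 - x)| < π`, `y ∈ ℂ`. -/
def psiDomain : Set (ℂ × ℂ) := {p | p.1 ≠ 1 ∧ |(1 - p.1).arg| < Real.pi}

/-- `F` is an analytic continuation to `psiDomain` of the sum of the double series, which converges
for `|x| < 1` and all `y`. As `psiDomain` is connected, `F` is determined there. -/
structure IsContinuation (a b c c' : ℂ) (F : ℂ × ℂ → ℂ) : Prop where
  analytic : AnalyticOnNhd ℂ F psiDomain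
  hasSum : ∀ x y : ℂ, ‖x‖ < 1 → HasSum (psiTerm a b c c' x y) (F (x, y))

open Classical in
/-- Humbert's function `Ψ₁[a, b; c, c'; x, y]`, continued analytically to `psiDomain`. (The value
`0` is used only if there is no continuation.) -/
noncomputable def Psi1 (a b c c' x y : ℂ) : ℂ :=
  if h : ∃ F, IsContinuation a b c c' F then h.choose (x, y) else 0

/-- `𝔣_γ(a, b) = Γ(γ) Γ(a - b) / (Γ(a) Γ(γ - b))`. In Mathlib `Γ` takes the value `0` at its poles,
so that the reciprocals of `Γ(a)` and `Γ(γ - b)` vanish at the poles, as they should. -/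
noncomputable def connCoeff (γ a b : ℂ) : ℂ :=
  Complex.Gamma γ * Complex.Gamma (a - b) / (Complex.Gamma a * Complex.Gamma (γ - b))

/-- The `n`-th term of `𝐔₁(x, y)`. -/
noncomputable def U1Term (a b c c' x y : ℂ) (n : ℕ) : ℂ :=
  poch a n / (n ! * poch c' n) * (poch (1 - c + a) n / poch (1 - b + a) n) *
    ordinaryHypergeometric (1 - c + a + n) (a + n) (1 - b + a + n) (1 / x) * (-(y / x)) ^ n

/-- The series `𝐔₁(x, y)`. -/
noncomputable def U1 (a b c c' x y : ℂ) : ℂ := ∑' n : ℕ, U1Term a b c c' x y n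

/-- The `n`-th term of `𝐔₂(x, y)`. -/
noncomputable def U2Term (a b c c' x y : ℂ) (n : ℕ) : ℂ :=
  poch (a - b) n / (n ! * poch c' n) *
    ordinaryHypergeometric (1 - c + b) b (1 - a - n + b) (1 / x) * y ^ n

/-- The series `𝐔₂(x, y)`. -/
noncomputable def U2 (a b c c' x y : ℂ) : ℂ := ∑' n : ℕ, U2Term a b c c' x y n

/-- The `k`-th term of the expansion of `𝐔₁` in powers of `1 / x`. -/
noncomputable def U1Exp (a b c c' x y : ℂ) (k : ℕ) : ℂ :=
  kummer (-k) c' y * (poch a k * poch (1 - c + a) k / (poch (1 - b + a) k * k !)) * (1 / x ^ k)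

/-- The `l`-th term of the expansion of `𝐔₂` in powers of `1 / x`. -/
noncomputable def U2Exp (a b c c' x y : ℂ) (l : ℕ) : ℂ :=
  kummer (a - b - l) c' y *
    (poch (1 - c + b) l * poch b l / (poch (1 - a + b) l * l !)) * (1 / x ^ l)

/-- The sector `|arg (-x)| < π`, `x ≠ 0`. -/
def sector : Set ℂ := {x | x ≠ 0 ∧ |(-x).arg| < Real.pi}

/-- The leading approximation
`𝔣_c(b, a) (-x)^(-a) + 𝔣_c(a, b) (-x)^(-b) ₁F₁[a - b; c'; y]`. -/
noncomputable def leading (a b c c' x y : ℂ) : ℂ :=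
  connCoeff c b a * (-x) ^ (-a) + connCoeff c a b * (-x) ^ (-b) * kummer (a - b) c' y

end Humbert

namespace Humbert

/-! ### Pochhammer symbols -/

/-! Summing the double series over `m` first gives `Ψ₁ = ∑ₙ kap n · yⁿ · fₙ(x)`, where `fₙ` is the
continuation of `₂F₁[a + n, b; c; x]` to the plane cut along `[1, ∞)`. The theorem is the Gauss
connection formula applied to every `fₙ`, summed over `n`, and rearranged. Three points need work.

Joint continuation. The Taylor multiplier `(b)ₘ / (c)ₘ` preserves holomorphy on the cut plane: for
`0 < Re b < Re c` it is Euler's integral, and other parameters are reached by differential operators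
and difference quotients (`hasMultiplier`). This also holds for functions with values in a Banach
space. Since `(1 - x)^(-(a + n))` is `(1 - x)^(-a)` times an `n`-th power, all the `fₙ`, suitably
weighted, form one holomorphic `ℓ¹`-valued function of `x`. Pairing it with a functional analytic in
`y` gives joint analyticity (`hasSum_and_analyticAt`), and connectedness of the domain identifies
the result with `Psi1`.

Gauss connection formula. At `x = -X`, `X > 2`, Euler's integral is cut at `t = 1/2`. On the left
`(1 - t)^(γ - 1)` is expanded, on the right `(1 + X t)^(-a)` in powers of `1 / (X t)`. Each
resulting incomplete beta integral is a quotient of Gamma values minus a series, where complete beta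
integrals that diverge are replaced by their continuations. The two double series of corrections are
the same up to sign and cancel (`integral_split`); the Gamma quotients add up to the two solutions
at infinity. The identity theorem passes from the negative axis to `|x| > 1`, and contiguous
relations, lowering `c` and then `b`, remove the restriction on the parameters (`hasConnection`).

Rearrangement. The shift `a ↦ a + n` changes the connection coefficients only by Pochhammer factors,
so the `n`-th terms are those of `𝐔₁` and `𝐔₂`. Both series, and their expansions in `1 / x`, are
iterated sums of one absolutely convergent double series `expTerm`. The expansions are power series
in `1 / x`, so their tails are bounded by the first omitted power, which gives the asymptotics. -/

@[simp]
theorem poch_zero (a : ℂ) : poch a 0 = 1 := by simp [poch]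

theorem poch_succ (a : ℂ) (n : ℕ) : poch a (n + 1) = poch a n * (a + n) := by
  simp [poch, ascPochhammer_succ_eval]

theorem poch_succ_left (a : ℂ) (n : ℕ) : poch a (n + 1) = a * poch (a + 1) n := by
  simp [poch, ascPochhammer_succ_left]

theorem poch_add (a : ℂ) (m n : ℕ) : poch a (m + n) = poch a m * poch (a + m) n := by
  simp [poch, ← ascPochhammer_mul]

theorem poch_one (n : ℕ) : poch 1 n = n ! := by
  simp [poch]

theorem poch_ne_zero {a : ℂ} (ha : ∀ n : ℕ, a ≠ -(n : ℂ)) (n : ℕ) : poch a n ≠ 0 := by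
  induction n with
  | zero => simp
  | succ n ih =>
    rw [poch_succ]
    exact mul_ne_zero ih fun h => ha n (eq_neg_of_add_eq_zero_left h)

theorem poch_mul_shift (a : ℂ) (n : ℕ) : poch a n * (a + n) = a * poch (a + 1) n := by
  rw [← poch_succ, poch_succ_left]

/-- The reflection `(z - n)ₙ = (-1)ⁿ (1 - z)ₙ`. -/
theorem poch_sub_self (z : ℂ) (n : ℕ) : poch (z - n) n = (-1) ^ n * poch (1 - z) n := by
  induction n generalizing z with
  | zero => simp
  | succ n ih =>
    rw [poch_succ, poch_succ_left (1 - z)]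
    have h := ih (z - 1)
    rw [show z - 1 - (n : ℂ) = z - (n + 1 : ℕ) by push_cast; ring] at h
    rw [h, show 1 - (z - 1) = 1 - z + 1 by ring]
    push_cast
    ring

/-- Split `(z - j)ₙ₊ⱼ` after `j` and after `n` factors, and reflect the block of length `j` each
time. This moves the shift by `j` in `𝐔₂` from one index to the other. -/
theorem poch_mul_poch_one_sub (z : ℂ) (n j : ℕ) :
    poch z n * poch (1 - z) j = poch (z - j) n * poch (1 - z - n) j := by
  have h1 := poch_add (z - j) j n
  have h2 := poch_add (z - j) n j
  rw [add_comm j n, sub_add_cancel, poch_sub_self] at h1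
  rw [show z - (j : ℂ) + n = (z + n) - j by ring, poch_sub_self,
    show 1 - (z + n) = 1 - z - (n : ℂ) by ring] at h2
  have h3 : ((-1 : ℂ) ^ j) ≠ 0 := by simp
  apply mul_left_cancel₀ h3
  linear_combination h2 - h1

theorem norm_poch_le {z : ℂ} {r : ℝ} (h : ‖z‖ ≤ r) (n : ℕ) : ‖poch z n‖ ≤ ‖poch (r : ℂ) n‖ := by
  have hr : 0 ≤ r := (norm_nonneg z).trans h
  induction n with
  | zero => simp
  | succ n ih =>
    rw [poch_succ, poch_succ, norm_mul, norm_mul]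
    refine mul_le_mul ih ?_ (norm_nonneg _) (norm_nonneg _)
    have : ‖(r : ℂ) + n‖ = r + n := by
      rw [show (r : ℂ) + n = ((r + n : ℝ) : ℂ) by push_cast; ring, Complex.norm_real,
        Real.norm_of_nonneg (by positivity)]
    rw [this]
    refine (norm_add_le _ _).trans ?_
    simpa using h

theorem norm_poch_ofReal {r : ℝ} (hr : 0 ≤ r) (n : ℕ) : (‖poch (r : ℂ) n‖ : ℂ) = poch r n := by
  induction n with
  | zero => simp
  | succ n ih =>
    rw [poch_succ, norm_mul]
    push_cast
    rw [ih, show (r : ℂ) + n = ((r + n : ℝ) : ℂ) by push_cast; ring, Complex.norm_real,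
        Real.norm_of_nonneg (by positivity)]

/-- Written for `1 / Γ`, which is entire, so that the poles of `Γ` need no exception. -/
theorem Gamma_inv_eq_poch_mul (z : ℂ) (n : ℕ) :
    (Complex.Gamma z)⁻¹ = poch z n * (Complex.Gamma (z + n))⁻¹ := by
  induction n with
  | zero => simp
  | succ n ih =>
    rw [ih, Complex.one_div_Gamma_eq_self_mul_one_div_Gamma_add_one (z + n), poch_succ]
    push_cast
    ring_nf

theorem Gamma_add_nat {z : ℂ} (hz : ∀ k : ℕ, z ≠ -(k : ℂ)) (n : ℕ) :
    Complex.Gamma (z + n) = poch z n * Complex.Gamma z := by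
  rw [poch, ← Complex.Gamma_add_nat_div_Gamma_eq z hz,
    div_mul_cancel₀ _ (Complex.Gamma_ne_zero hz)]

/-! ### Coefficients of the hypergeometric series -/

/-- The coefficients of the Gauss hypergeometric series. -/
noncomputable def hyp (a b c : ℂ) (n : ℕ) : ℂ := poch a n * poch b n / (poch c n * n !)

/-- Valid for every `c`: once `(c)ₙ` vanishes, all later coefficients are `0` by the convention on
division. -/
theorem hyp_succ (a b c : ℂ) (n : ℕ) :
    hyp a b c (n + 1) = hyp a b c n * ((a + n) * (b + n) / ((c + n) * (n + 1))) := by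
  simp only [hyp, poch_succ, Nat.factorial_succ]
  push_cast
  rw [div_mul_div_comm]
  ring_nf

/-- The ratio test in multiplicative form, so that terminating series are covered. -/
theorem summable_of_ratio_tendsto {f : ℕ → ℂ} {q : ℕ → ℂ} {l : ℂ} (hl : ‖l‖ < 1)
    (hf : ∀ n, f (n + 1) = f n * q n) (hq : Tendsto q atTop (nhds l)) :
    Summable fun n => ‖f n‖ := by
  obtain ⟨r, h1, h2⟩ := exists_between hl
  have h3 : ∀ᶠ n in atTop, ‖q n‖ < r := hq.norm.eventually_lt_const h1
  refine summable_of_ratio_norm_eventually_le h2 (h3.mono fun n hn => ?_)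
  rw [norm_norm, norm_norm, hf, norm_mul, mul_comm]
  exact mul_le_mul_of_nonneg_right hn.le (norm_nonneg _)

theorem tendsto_add_div_add (a c : ℂ) :
    Tendsto (fun n : ℕ => (a + n) / (c + n)) atTop (nhds 1) := by
  have h : Tendsto (fun n : ℕ => (a / n + 1) / (c / n + 1)) atTop (nhds ((0 + 1) / (0 + 1))) :=
    ((tendsto_const_div_atTop_nhds_zero_nat a).add_const 1).div
      ((tendsto_const_div_atTop_nhds_zero_nat c).add_const 1) (by simp)
  have h1 : ((0 : ℂ) + 1) / (0 + 1) = 1 := by simp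
  rw [h1] at h
  refine h.congr' ?_
  filter_upwards [eventually_gt_atTop 0] with n hn
  have hn' : (n : ℂ) ≠ 0 := by exact_mod_cast hn.ne'
  rw [div_add_one hn', div_add_one hn', div_div_div_cancel_right₀ hn']

theorem tendsto_const_div_add (c : ℂ) (y : ℂ) :
    Tendsto (fun n : ℕ => y / (c + n)) atTop (nhds 0) := by
  have h : Tendsto (fun n : ℕ => (y / n) / (c / n + 1)) atTop (nhds (0 / (0 + 1))) :=
    (tendsto_const_div_atTop_nhds_zero_nat y).div
      ((tendsto_const_div_atTop_nhds_zero_nat c).add_const 1) (by simp)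
  have h1 : (0 : ℂ) / (0 + 1) = 0 := by simp
  rw [h1] at h
  refine h.congr' ?_
  filter_upwards [eventually_gt_atTop 0] with n hn
  have hn' : (n : ℂ) ≠ 0 := by exact_mod_cast hn.ne'
  rw [div_add_one hn', div_div_div_cancel_right₀ hn']

theorem summable_hyp (a b c : ℂ) {z : ℂ} (hz : ‖z‖ < 1) :
    Summable fun n => ‖hyp a b c n * z ^ n‖ := by
  refine summable_of_ratio_tendsto (q := fun n : ℕ => (a + n) / (c + n) * ((b + n) / (1 + n)) * z)
    (l := z) hz (fun n => ?_) ?_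
  · rw [hyp_succ, pow_succ]
    rw [div_mul_div_comm, add_comm (1 : ℂ)]
    ring
  · simpa using ((tendsto_add_div_add a c).mul (tendsto_add_div_add b 1)).mul_const z

theorem summable_poch_div_poch (b c : ℂ) {z : ℂ} (hz : ‖z‖ < 1) :
    Summable fun n => ‖poch b n / poch c n * z ^ n‖ := by
  refine (summable_hyp b 1 c hz).congr fun n => ?_
  rw [hyp, poch_one, mul_div_mul_right _ _ (by exact_mod_cast n.factorial_ne_zero)]

theorem summable_pow_div_poch (c y : ℂ) : Summable fun n => ‖y ^ n / poch c n‖ := by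
  refine summable_of_ratio_tendsto (q := fun n : ℕ => y / (c + n)) (l := 0) (by simp)
    (fun n => ?_) (tendsto_const_div_add c y)
  rw [poch_succ, pow_succ, div_mul_div_comm]

theorem summable_kummer (a c y : ℂ) :
    Summable fun n => ‖poch a n / (poch c n * n !) * y ^ n‖ := by
  refine summable_of_ratio_tendsto
    (q := fun n : ℕ => (a + n) / (c + n) * (y / (1 + n))) (l := 0) (by simp)
    (fun n => ?_) (by simpa using (tendsto_add_div_add a c).mul (tendsto_const_div_add 1 y))
  rw [poch_succ, poch_succ, pow_succ, Nat.factorial_succ, div_mul_div_comm, div_mul_eq_mul_div,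
    div_mul_eq_mul_div, div_mul_div_comm]
  push_cast
  ring_nf

/-! ### Sums of power series in the unit disc -/

section PowerSum

variable {E : Type*} [NormedAddCommGroup E] [NormedSpace ℂ E]

/-- `G` is the sum of the power series with coefficients `g` in the open unit disc. -/
def IsPowerSum (g : ℕ → E) (G : ℂ → E) : Prop :=
  ∀ z : ℂ, ‖z‖ < 1 → HasSum (fun n => z ^ n • g n) (G z)

/-- The coefficients of `z G(z)`. -/
def shift (g : ℕ → E) : ℕ → E
  | 0 => 0
  | n + 1 => g n

namespace IsPowerSum

variable {g h : ℕ → E} {G H : ℂ → E}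

theorem add (hg : IsPowerSum g G) (hh : IsPowerSum h H) :
    IsPowerSum (fun n => g n + h n) (fun z => G z + H z) := fun z hz => by
  simpa only [smul_add] using (hg z hz).add (hh z hz)

theorem const_smul (hg : IsPowerSum g G) (k : ℂ) :
    IsPowerSum (fun n => k • g n) (fun z => k • G z) := fun z hz => by
  simpa only [smul_comm k] using (hg z hz).const_smul k

theorem map {F : Type*} [NormedAddCommGroup F] [NormedSpace ℂ F] (L : E →L[ℂ] F)
    (hg : IsPowerSum g G) : IsPowerSum (fun n => L (g n)) (fun z => L (G z)) := fun z hz => by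
  simpa only [Function.comp_def, map_smul] using (L.hasSum (hg z hz))

theorem apply_zero (hg : IsPowerSum g G) : G 0 = g 0 := by
  refine (hg 0 (by simp)).unique ?_
  convert! hasSum_single (f := fun n => (0 : ℂ) ^ n • g n) 0 (fun n hn => by simp [hn])
  simp

theorem id_smul (hg : IsPowerSum g G) :
    IsPowerSum (shift g) (fun z => z • G z) := fun z hz => by
  have h := ((hg z hz).const_smul z)
  have h2 : HasSum (fun n => z ^ (n + 1) • shift g (n + 1)) (z • G z) := by
    simpa only [shift, smul_smul, ← pow_succ'] using h
  have h3 := HasSum.zero_add (f := fun n => z ^ n • shift g n) h2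
  rwa [shift, smul_zero, zero_add] at h3

/-- Abel's argument: at a radius `s` between `r` and `1` the terms are bounded, so at `r` they are
dominated by a geometric series of ratio `r / s`. -/
theorem norm_bound (hg : IsPowerSum g G) {r : ℝ} (hr0 : 0 ≤ r) (hr : r < 1) :
    Summable fun n => r ^ n * ‖g n‖ := by
  obtain ⟨s, h1, h2⟩ := exists_between hr
  have hs : 0 < s := hr0.trans_lt h1
  have h3 := (hg s (by simpa [abs_of_pos hs] using h2)).summable.tendsto_atTop_zero
  obtain ⟨C, hC⟩ := h3.norm.bddAbove_range
  have hC' : ∀ n, s ^ n * ‖g n‖ ≤ C := fun n => by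
    have := hC ⟨n, rfl⟩
    simpa [norm_smul, abs_of_pos hs] using this
  have hq : r / s < 1 := (div_lt_one hs).2 h1
  refine Summable.of_nonneg_of_le (fun n => by positivity) (fun n => ?_)
    ((summable_geometric_of_lt_one (div_nonneg hr0 hs.le) hq).mul_left C)
  have : r ^ n * ‖g n‖ = (s ^ n * ‖g n‖) * (r / s) ^ n := by
    rw [div_pow]; field_simp
  rw [this]
  exact mul_le_mul_of_nonneg_right (hC' n) (by positivity)

variable [CompleteSpace E]

theorem hasSum_deriv (hg : IsPowerSum g G) {z : ℂ} (hz : ‖z‖ < 1) :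
    HasSum (fun n => deriv (fun w : ℂ => w ^ n • g n) z) (deriv G z) ∧ DifferentiableAt ℂ G z := by
  obtain ⟨r, h1, h2⟩ := exists_between hz
  have hr0 : 0 ≤ r := (norm_nonneg z).trans h1.le
  have hd : ∀ n : ℕ, DifferentiableOn ℂ (fun w : ℂ => w ^ n • g n) (Metric.ball 0 r) :=
    fun n => by fun_prop
  have hb : ∀ (n : ℕ) (w : ℂ), w ∈ Metric.ball (0 : ℂ) r → ‖w ^ n • g n‖ ≤ r ^ n * ‖g n‖ := by
    intro n w hw
    rw [norm_smul, norm_pow]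
    gcongr
    simpa using (mem_ball_zero_iff.1 hw).le
  have hz' : z ∈ Metric.ball (0 : ℂ) r := by simpa using h1
  have heq : (fun w : ℂ => ∑' n, w ^ n • g n) =ᶠ[nhds z] G := by
    filter_upwards [Metric.isOpen_ball.mem_nhds hz'] with w hw
    exact (hg w ((mem_ball_zero_iff.1 hw).trans h2)).tsum_eq
  have h3 := Complex.hasSum_deriv_of_summable_norm (hg.norm_bound hr0 h2) hd
    Metric.isOpen_ball hb hz'
  have h4 := Complex.differentiableOn_tsum_of_summable_norm (hg.norm_bound hr0 h2) hd
    Metric.isOpen_ball hb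
  exact ⟨heq.deriv_eq ▸ h3,
    heq.differentiableAt_iff.1 (h4.differentiableAt (Metric.isOpen_ball.mem_nhds hz'))⟩

theorem differentiableAt (hg : IsPowerSum g G) {z : ℂ} (hz : ‖z‖ < 1) : DifferentiableAt ℂ G z :=
  (hg.hasSum_deriv hz).2

theorem deriv (hg : IsPowerSum g G) :
    IsPowerSum (fun n => ((n : ℂ) + 1) • g (n + 1)) (deriv G) := fun z hz => by
  have h := (hg.hasSum_deriv hz).1
  rw [← hasSum_nat_add_iff' 1] at h
  simp only [Finset.range_one, Finset.sum_singleton, pow_zero, one_smul, deriv_const, sub_zero] at h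
  refine h.congr_fun fun n => ?_
  rw [deriv_smul_const (by fun_prop), deriv_pow_field, smul_smul]
  push_cast
  simp [mul_comm]

theorem euler (hg : IsPowerSum g G) :
    IsPowerSum (fun n => (n : ℂ) • g n) (fun z => z • _root_.deriv G z) := by
  refine fun z hz => (hg.deriv.id_smul z hz).congr_fun fun n => ?_
  cases n <;> simp [shift]

/-- The value at `0` gives the constant coefficient; differentiation gives the others by induction.
-/
theorem coeff_unique (hg : IsPowerSum g G) (hh : IsPowerSum h H)
    (heq : ∀ z : ℂ, ‖z‖ < 1 → G z = H z) : g = h := by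
  funext n
  induction n generalizing g h G H with
  | zero => rw [← hg.apply_zero, ← hh.apply_zero, heq 0 (by simp)]
  | succ n ih =>
    have h1 := ih hg.deriv hh.deriv fun z hz => by
      refine EventuallyEq.deriv_eq ?_
      filter_upwards [Metric.isOpen_ball.mem_nhds (show z ∈ Metric.ball (0 : ℂ) 1 by simpa using hz)]
        with w hw
      exact heq w (by simpa using hw)
    have h2 : (n : ℂ) + 1 ≠ 0 := by exact_mod_cast n.succ_ne_zero
    exact smul_right_injective E h2 h1

end IsPowerSum

theorem exists_isPowerSum [CompleteSpace E] {G : ℂ → E}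
    (hG : DifferentiableOn ℂ G (Metric.ball 0 1)) : ∃ g, IsPowerSum g G := by
  refine ⟨fun n => (n ! : ℂ)⁻¹ • iteratedDeriv n G 0, fun z hz => ?_⟩
  have := Complex.hasSum_taylorSeries_on_ball hG (z := z) (by simpa using hz)
  simpa only [sub_zero, smul_comm (z ^ _)] using this

end PowerSum

theorem isPowerSum_hyp (a b c : ℂ) :
    IsPowerSum (hyp a b c) (ordinaryHypergeometric a b c) := fun z hz => by
  have h := (summable_hyp a b c hz).of_norm
  rw [ordinaryHypergeometric_eq_tsum]
  convert! h.hasSum using 1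
  · funext n
    rw [smul_eq_mul, mul_comm]
  · refine tsum_congr fun n => ?_
    rw [hyp, smul_eq_mul, poch, poch, poch]
    field_simp

theorem isPowerSum_one_sub_cpow (a : ℂ) :
    IsPowerSum (fun n => poch a n / n !) (fun z => (1 - z) ^ (-a)) := fun z hz => by
  have h := (Complex.one_div_one_sub_cpow_hasFPowerSeriesOnBall_zero a).hasSum (y := z) (by
    rw [← ENNReal.ofReal_one, Metric.eball_ofReal]; simpa using hz)
  simp only [zero_add, one_div, ← Complex.cpow_neg] at h
  refine h.congr_fun fun n => ?_
  simp only [FormalMultilinearSeries.ofScalars_apply_eq, smul_eq_mul]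
  rw [mul_comm]
  congr 1
  have h1 := Ring.descPochhammer_eq_factorial_smul_choose (a + n - 1) n
  rw [div_eq_iff (by exact_mod_cast n.factorial_ne_zero), mul_comm, ← nsmul_eq_mul, ← h1,
    Polynomial.descPochhammer_smeval_eq_ascPochhammer, Polynomial.ascPochhammer_smeval_eq_eval, poch]
  congr 1
  ring

/-! ### The cut plane -/

/-- The complex plane cut along `[1, ∞)`. -/
def cutPlane : Set ℂ := {x | 1 - x ∈ Complex.slitPlane}

theorem isOpen_cutPlane : IsOpen cutPlane :=
  Complex.isOpen_slitPlane.preimage (by fun_prop)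

theorem zero_mem_cutPlane : (0 : ℂ) ∈ cutPlane := by simp [cutPlane]

theorem starConvex_cutPlane : StarConvex ℝ 0 cutPlane := by
  intro x hx s t hs ht hst
  have h := Complex.starConvex_one_slitPlane hx hs ht hst
  rw [cutPlane, Set.mem_ofPred_eq]
  convert! h using 1
  have : (s : ℂ) + t = 1 := by exact_mod_cast hst
  simp only [smul_zero, zero_add, Complex.real_smul]
  linear_combination -this

theorem mul_mem_cutPlane {x : ℂ} (hx : x ∈ cutPlane) {t : ℝ} (h0 : 0 ≤ t) (h1 : t ≤ 1) :
    x * t ∈ cutPlane := by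
  have := starConvex_cutPlane.smul_mem hx h0 h1
  rwa [Complex.real_smul, mul_comm] at this

theorem isPreconnected_cutPlane : IsPreconnected cutPlane :=
  (starConvex_cutPlane.isPathConnected zero_mem_cutPlane).isConnected.isPreconnected

theorem mem_cutPlane_of_norm_lt_one {z : ℂ} (hz : ‖z‖ < 1) : z ∈ cutPlane := by
  have := Complex.mem_slitPlane_of_norm_lt_one (z := -z) (by simpa using hz)
  simpa [cutPlane, sub_eq_add_neg] using this

theorem ball_subset_cutPlane : Metric.ball (0 : ℂ) 1 ⊆ cutPlane :=
  fun _ hz => mem_cutPlane_of_norm_lt_one (by simpa using hz)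

/-- The cut plane is connected, so a continuation to it is determined by its Taylor coefficients at
`0`. Identities between continuations thereby reduce to identities between coefficients. -/
theorem eqOn_cutPlane {E : Type*} [NormedAddCommGroup E] [NormedSpace ℂ E] [CompleteSpace E]
    {G H : ℂ → E} {g : ℕ → E} (hG : DifferentiableOn ℂ G cutPlane)
    (hH : DifferentiableOn ℂ H cutPlane) (h1 : IsPowerSum g G) (h2 : IsPowerSum g H) :
    Set.EqOn G H cutPlane := by
  refine (hG.analyticOnNhd isOpen_cutPlane).eqOn_of_preconnected_of_eventuallyEq
    (hH.analyticOnNhd isOpen_cutPlane) isPreconnected_cutPlane zero_mem_cutPlane ?_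
  filter_upwards [Metric.ball_mem_nhds (0 : ℂ) one_pos] with z hz
  rw [mem_ball_zero_iff] at hz
  exact (h1 z hz).unique (h2 z hz)

/-! ### The multiplier `(b)ₘ / (c)ₘ` on power series that continue to the cut plane -/

section Multiplier

variable {E : Type*} [NormedAddCommGroup E] [NormedSpace ℂ E]

/-- The weight of Euler's integral. -/
noncomputable def eulerWeight (b c : ℂ) (t : ℝ) : ℂ := (t : ℂ) ^ (b - 1) * (1 - (t : ℂ)) ^ (c - b - 1)

/-- Euler's integral transform. -/
noncomputable def eulerIntegral (b c : ℂ) (G : ℂ → E) (x : ℂ) : E :=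
  (Complex.Gamma c / (Complex.Gamma b * Complex.Gamma (c - b))) •
    ∫ t in (0 : ℝ)..1, eulerWeight b c t • G (x * t)

theorem intervalIntegrable_eulerWeight {b c : ℂ} (hb : 0 < b.re) (hc : b.re < c.re) :
    IntervalIntegrable (eulerWeight b c) MeasureTheory.volume 0 1 :=
  Complex.betaIntegral_convergent hb (by simpa using hc)

theorem continuousOn_comp_mul {X : Type*} [TopologicalSpace X] {G : ℂ → X} (hG : ContinuousOn G cutPlane) {x : ℂ}
    (hx : x ∈ cutPlane) : ContinuousOn (fun t : ℝ => G (x * t)) (Set.Icc 0 1) :=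
  hG.comp (by fun_prop) fun _ ht => mul_mem_cutPlane hx ht.1 ht.2

theorem aestronglyMeasurable_comp_mul {X : Type*} [NormedAddCommGroup X] {G : ℂ → X} (hG : ContinuousOn G cutPlane) {x : ℂ}
    (hx : x ∈ cutPlane) : MeasureTheory.AEStronglyMeasurable (fun t : ℝ => G (x * t))
      (MeasureTheory.volume.restrict (Set.uIoc (0 : ℝ) 1)) := by
  rw [Set.uIoc_of_le zero_le_one]
  exact ((continuousOn_comp_mul hG hx).mono Set.Ioc_subset_Icc_self).aestronglyMeasurable
    measurableSet_Ioc

theorem aestronglyMeasurable_eulerWeight {b c : ℂ} (hb : 0 < b.re) (hc : b.re < c.re) :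
    MeasureTheory.AEStronglyMeasurable (eulerWeight b c)
      (MeasureTheory.volume.restrict (Set.uIoc (0 : ℝ) 1)) := by
  rw [Set.uIoc_of_le zero_le_one]
  exact (intervalIntegrable_eulerWeight hb hc).aestronglyMeasurable

variable [CompleteSpace E]

theorem differentiableOn_eulerIntegral {b c : ℂ} (hb : 0 < b.re) (hc : b.re < c.re) {G : ℂ → E}
    (hG : DifferentiableOn ℂ G cutPlane) : DifferentiableOn ℂ (eulerIntegral b c G) cutPlane := by
  intro x₀ hx₀
  obtain ⟨ε, hε, hball⟩ := Metric.nhds_basis_closedBall.mem_iff.1 (isOpen_cutPlane.mem_nhds hx₀)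
  have hG' : ContinuousOn (deriv G) cutPlane := (hG.deriv isOpen_cutPlane).continuousOn
  -- The points `x t` with `x` near `x₀` and `0 ≤ t ≤ 1` fill a compact subset of the cut plane,
  -- because the cut plane is star-shaped about `0`. This bounds `deriv G` uniformly and permits
  -- differentiation under the integral.
  have hK : IsCompact ((fun p : ℂ × ℝ => p.1 * p.2) ''
      (Metric.closedBall x₀ ε ×ˢ Set.Icc (0 : ℝ) 1)) :=
    ((isCompact_closedBall x₀ ε).prod isCompact_Icc).image (by fun_prop)
  obtain ⟨C, hC⟩ := hK.exists_bound_of_continuousOn (f := deriv G) (hG'.mono (by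
    rintro _ ⟨p, hp, rfl⟩
    exact mul_mem_cutPlane (hball hp.1) hp.2.1 hp.2.2))
  have hw := intervalIntegrable_eulerWeight hb hc
  have hwm := aestronglyMeasurable_eulerWeight hb hc
  have key := intervalIntegral.hasDerivAt_integral_of_dominated_loc_of_deriv_le
    (μ := MeasureTheory.volume) (a := 0) (b := 1) (x₀ := x₀) (s := Metric.ball x₀ ε)
    (bound := fun t => ‖eulerWeight b c t‖ * C)
    (F := fun x t => eulerWeight b c t • G (x * t))
    (F' := fun x t => eulerWeight b c t • ((t : ℂ) • deriv G (x * t)))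
    (Metric.ball_mem_nhds x₀ hε) ?_ ?_ ?_ ?_ ?_ ?_
  · exact (key.2.differentiableAt.const_smul _).differentiableWithinAt
  · filter_upwards [isOpen_cutPlane.mem_nhds hx₀] with x hx
    exact hwm.smul (aestronglyMeasurable_comp_mul hG.continuousOn hx)
  · exact hw.smul_continuousOn (by
      rw [Set.uIcc_of_le zero_le_one]
      exact continuousOn_comp_mul hG.continuousOn hx₀)
  · refine hwm.smul (MeasureTheory.AEStronglyMeasurable.smul ?_
      (aestronglyMeasurable_comp_mul hG' hx₀))
    exact Complex.continuous_ofReal.aestronglyMeasurable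
  · refine Eventually.of_forall fun t ht x hx => ?_
    rw [Set.uIoc_of_le zero_le_one] at ht
    rw [norm_smul, norm_smul]
    refine mul_le_mul_of_nonneg_left ?_ (norm_nonneg _)
    have h1 : ‖deriv G (x * t)‖ ≤ C :=
      hC _ ⟨(x, t), ⟨Metric.ball_subset_closedBall hx, ht.1.le, ht.2⟩, rfl⟩
    have h2 : ‖(t : ℂ)‖ ≤ 1 := by simpa [abs_of_pos ht.1] using ht.2
    calc _ ≤ 1 * ‖deriv G (x * t)‖ := mul_le_mul_of_nonneg_right h2 (norm_nonneg _)
      _ ≤ C := by rwa [one_mul]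
  · exact hw.norm.mul_const C
  · refine Eventually.of_forall fun t ht x hx => ?_
    rw [Set.uIoc_of_le zero_le_one] at ht
    have hm : x * t ∈ cutPlane :=
      mul_mem_cutPlane (hball (Metric.ball_subset_closedBall hx)) ht.1.le ht.2
    have h1 : HasDerivAt G (deriv G (x * t)) (x * t) :=
      (hG.differentiableAt (isOpen_cutPlane.mem_nhds hm)).hasDerivAt
    have h2 : HasDerivAt (fun x : ℂ => x * (t : ℂ)) (t : ℂ) x := by
      simpa using (hasDerivAt_id x).mul_const (t : ℂ)
    exact (h1.scomp x h2).const_smul _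

theorem integral_eulerWeight_mul_pow {b c : ℂ} (hb : 0 < b.re) (hc : b.re < c.re) (n : ℕ) :
    (Complex.Gamma c / (Complex.Gamma b * Complex.Gamma (c - b))) *
      ∫ t in (0 : ℝ)..1, eulerWeight b c t * (t : ℂ) ^ n = poch b n / poch c n := by
  have h1 : ∫ t in (0 : ℝ)..1, eulerWeight b c t * (t : ℂ) ^ n =
      Complex.betaIntegral (b + n) (c - b) := by
    rw [Complex.betaIntegral]
    refine intervalIntegral.integral_congr_ae (Eventually.of_forall fun t ht => ?_)
    rw [Set.uIoc_of_le zero_le_one] at ht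
    have ht0 : (t : ℂ) ≠ 0 := by exact_mod_cast ht.1.ne'
    rw [eulerWeight, show b + n - 1 = (b - 1) + n by ring, Complex.cpow_add _ _ ht0,
      Complex.cpow_natCast]
    ring
  have hcb : 0 < (c - b).re := by simpa using hc
  have hc0 : 0 < c.re := hb.trans hc
  have hb0 : ∀ k : ℕ, b ≠ -(k : ℂ) := fun k h => by
    have := congrArg Complex.re h
    simp at this
    have hk : (0 : ℝ) ≤ k := k.cast_nonneg
    linarith
  have hc0' : ∀ k : ℕ, c ≠ -(k : ℂ) := fun k h => by
    have := congrArg Complex.re h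
    simp at this
    have hk : (0 : ℝ) ≤ k := k.cast_nonneg
    linarith
  rw [h1, Complex.betaIntegral_eq_Gamma_mul_div _ _ (by simp; positivity) hcb,
    show b + n + (c - b) = c + n by ring, Gamma_add_nat hb0, Gamma_add_nat hc0']
  have := Complex.Gamma_ne_zero hb0
  have := Complex.Gamma_ne_zero hc0'
  have := Complex.Gamma_ne_zero_of_re_pos hcb
  have := poch_ne_zero hc0' n
  field_simp

theorem isPowerSum_eulerIntegral {b c : ℂ} (hb : 0 < b.re) (hc : b.re < c.re) {G : ℂ → E}
    {g : ℕ → E} (hg : IsPowerSum g G) :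
    IsPowerSum (fun m => (poch b m / poch c m) • g m) (eulerIntegral b c G) := by
  intro x hx
  have hw := intervalIntegrable_eulerWeight hb hc
  have hw' : MeasureTheory.IntegrableOn (eulerWeight b c) (Set.Ioc 0 1) := hw.1
  have hint : ∀ n : ℕ, MeasureTheory.Integrable
      (fun t : ℝ => eulerWeight b c t • ((x * t) ^ n • g n))
      (MeasureTheory.volume.restrict (Set.Ioc 0 1)) := fun n =>
    (hw.smul_continuousOn (f := eulerWeight b c) (g := fun t : ℝ => (x * t) ^ n • g n)
      (by fun_prop)).1
  have hsum : Summable fun n : ℕ =>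
      ∫ t in Set.Ioc (0 : ℝ) 1, ‖eulerWeight b c t • ((x * t) ^ n • g n)‖ := by
    refine Summable.of_nonneg_of_le
      (fun n => MeasureTheory.integral_nonneg fun t => norm_nonneg _) (fun n => ?_)
      ((hg.norm_bound (norm_nonneg x) hx).mul_left
        (∫ t in Set.Ioc (0 : ℝ) 1, ‖eulerWeight b c t‖))
    rw [← MeasureTheory.integral_mul_const]
    refine MeasureTheory.setIntegral_mono_on (hint n).norm (hw'.norm.mul_const _)
      measurableSet_Ioc fun t ht => ?_
    rw [norm_smul, norm_smul, norm_pow, norm_mul]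
    have h2 : ‖(t : ℂ)‖ ≤ 1 := by simpa [abs_of_pos ht.1] using ht.2
    gcongr
    exact mul_le_of_le_one_right (norm_nonneg x) h2
  have key := MeasureTheory.hasSum_integral_of_summable_integral_norm hint hsum
  have h3 : ∫ t in Set.Ioc (0 : ℝ) 1, ∑' n : ℕ, eulerWeight b c t • ((x * t) ^ n • g n) =
      ∫ t in (0 : ℝ)..1, eulerWeight b c t • G (x * t) := by
    rw [intervalIntegral.integral_of_le zero_le_one]
    refine MeasureTheory.setIntegral_congr_fun measurableSet_Ioc fun t ht => ?_
    have h2 : ‖x * (t : ℂ)‖ < 1 := by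
      rw [norm_mul]
      refine (mul_le_of_le_one_right (norm_nonneg x) ?_).trans_lt hx
      simpa [abs_of_pos ht.1] using ht.2
    exact ((hg _ h2).const_smul _).tsum_eq
  rw [h3] at key
  refine (key.const_smul (Complex.Gamma c / (Complex.Gamma b * Complex.Gamma (c - b)))).congr_fun
    fun n => ?_
  beta_reduce
  rw [← integral_eulerWeight_mul_pow hb hc n, ← intervalIntegral.integral_of_le zero_le_one]
  have h4 : ∀ t : ℝ, eulerWeight b c t • ((x * t) ^ n • g n) =
      (eulerWeight b c t * (t : ℂ) ^ n) • (x ^ n • g n) := fun t => by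
    rw [smul_smul, smul_smul, mul_pow]
    congr 1
    ring
  simp only [h4]
  rw [intervalIntegral.integral_smul_const]
  simp only [smul_smul]
  congr 1
  ring

/-- The multiplier `(b)ₘ / (c)ₘ` preserves continuation to the cut plane. -/
def HasMultiplier (E : Type*) [NormedAddCommGroup E] [NormedSpace ℂ E] (b c : ℂ) : Prop :=
  ∀ (G : ℂ → E) (g : ℕ → E), DifferentiableOn ℂ G cutPlane → IsPowerSum g G →
    ∃ H : ℂ → E, DifferentiableOn ℂ H cutPlane ∧ IsPowerSum (fun m => (poch b m / poch c m) • g m) H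

theorem hasMultiplier_of_re {b c : ℂ} (hb : 0 < b.re) (hc : b.re < c.re) : HasMultiplier E b c :=
  fun G _ hG hg => ⟨eulerIntegral b c G, differentiableOn_eulerIntegral hb hc hG,
    isPowerSum_eulerIntegral hb hc hg⟩

/-- Since `1 / (c)ₘ = (1 + m / c) / (c + 1)ₘ`, the multiplier for `c` is the one for `c + 1`
followed by `1 + c⁻¹ x d/dx`. -/
theorem HasMultiplier.of_succ_right {b c : ℂ} (hc : ∀ n : ℕ, c ≠ -(n : ℂ))
    (h : HasMultiplier E b (c + 1)) : HasMultiplier E b c := by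
  intro G g hG hg
  obtain ⟨H, hH, hs⟩ := h G g hG hg
  refine ⟨fun x => H x + c⁻¹ • (x • deriv H x), ?_, ?_⟩
  · exact hH.add ((differentiableOn_id.smul (hH.deriv isOpen_cutPlane)).const_smul _)
  · refine fun z hz => ((hs.add (hs.euler.const_smul c⁻¹)) z hz).congr_fun fun n => ?_
    congr 1
    have hc0 : c ≠ 0 := by simpa using hc 0
    have hc1 : ∀ n : ℕ, c + 1 ≠ -(n : ℂ) := fun n hn => hc (n + 1) (by
      push_cast; linear_combination hn)
    beta_reduce
    rw [smul_smul, smul_smul, ← add_smul]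
    congr 1
    have h1 := poch_mul_shift c n
    have h2 := poch_ne_zero hc n
    have h3 := poch_ne_zero hc1 n
    field_simp
    linear_combination -poch b n * h1

/-- Since `(b)ₘ₊₁ / (c)ₘ₊₁ = (b / c) (b + 1)ₘ / (c + 1)ₘ`, split off the constant term and apply the
shifted multiplier to the difference quotient of `G` at `0`. -/
theorem HasMultiplier.of_succ_succ {b c : ℂ}
    (h : HasMultiplier E (b + 1) (c + 1)) : HasMultiplier E b c := by
  intro G g hG hg
  have hz : cutPlane ∈ nhds (0 : ℂ) := isOpen_cutPlane.mem_nhds zero_mem_cutPlane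
  have hds : IsPowerSum (fun n => g (n + 1)) (dslope G 0) := by
    intro z hz
    by_cases hz0 : z = 0
    · subst hz0
      have h1 := hg.deriv.apply_zero
      rw [dslope_same, h1]
      convert! hasSum_single (f := fun n => (0 : ℂ) ^ n • g (n + 1)) 0 (fun n hn => by simp [hn])
      simp
    · have h1 := (hasSum_nat_add_iff' 1).2 (hg z hz)
      have h2 := h1.const_smul z⁻¹
      rw [dslope_of_ne _ hz0, slope_def_module, hg.apply_zero]
      simp only [Finset.range_one, Finset.sum_singleton, pow_zero, one_smul] at h2
      rw [sub_zero]
      refine h2.congr_fun fun n => ?_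
      rw [smul_smul, pow_succ', inv_mul_cancel_left₀ hz0]
  obtain ⟨H, hH, hs⟩ := h _ _ ((Complex.differentiableOn_dslope hz).2 hG) hds
  refine ⟨fun x => g 0 + (b / c) • (x • H x), ?_, ?_⟩
  · exact ((differentiableOn_id.smul hH).const_smul _).const_add _
  · intro z hz
    have h1 := (((hs z hz).const_smul z).const_smul (b / c))
    rw [show g 0 = z ^ 0 • ((poch b 0 / poch c 0) • g 0) by simp]
    refine HasSum.zero_add (f := fun m => z ^ m • ((poch b m / poch c m) • g m)) ?_
    refine h1.congr_fun fun n => ?_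
    simp only [smul_smul]
    congr 1
    rw [poch_succ_left, poch_succ_left, pow_succ', mul_div_mul_comm]
    ring

/-- Raise `b` and `c` together until `Re b > 0`, then raise `c` alone until `Re b < Re c`, where
Euler's integral applies. -/
theorem hasMultiplier (b : ℂ) {c : ℂ} (hc : ∀ n : ℕ, c ≠ -(n : ℂ)) : HasMultiplier E b c := by
  have shift_right : ∀ (n : ℕ) (b c : ℂ), (∀ n : ℕ, c ≠ -(n : ℂ)) → 0 < b.re → b.re < c.re + n →
      HasMultiplier E b c := by
    intro n
    induction n with
    | zero => intro b c _ hb hbc; exact hasMultiplier_of_re hb (by simpa using hbc)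
    | succ n ih =>
      intro b c hc hb hbc
      refine HasMultiplier.of_succ_right hc (ih b (c + 1) (fun n hn => hc (n + 1) ?_) hb ?_)
      · push_cast; linear_combination hn
      · simp only [Complex.add_re, Complex.one_re]; push_cast at hbc; linarith
  have shift_left : ∀ (n : ℕ) (b c : ℂ), (∀ n : ℕ, c ≠ -(n : ℂ)) → 0 < b.re + n →
      HasMultiplier E b c := by
    intro n
    induction n with
    | zero =>
      intro b c hc hb
      obtain ⟨m, hm⟩ := exists_nat_gt (b.re - c.re)
      exact shift_right m b c hc (by simpa using hb) (by linarith)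
    | succ n ih =>
      intro b c hc hb
      refine HasMultiplier.of_succ_succ (ih (b + 1) (c + 1) (fun n hn => hc (n + 1) ?_) ?_)
      · push_cast; linear_combination hn
      · simp only [Complex.add_re, Complex.one_re]; push_cast at hb; linarith
  obtain ⟨n, hn⟩ := exists_nat_gt (-b.re)
  exact shift_left n b c hc (by linarith)

end Multiplier

/-! ### Regularized beta integrals -/

theorem re_ne_neg_natCast {s : ℂ} (hs : 0 < s.re) (n : ℕ) : s ≠ -(n : ℂ) := fun h => by
  have := congrArg Complex.re h
  simp only [Complex.neg_re, Complex.natCast_re] at this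
  have hk : (0 : ℝ) ≤ n := n.cast_nonneg
  linarith

/-- Termwise integration of a power series in `τ t` against an integrable weight. -/
theorem IsPowerSum.hasSum_integral {g : ℕ → ℂ} {G : ℂ → ℂ} (hg : IsPowerSum g G) {α β r : ℝ}
    (hαβ : α ≤ β) {W : ℝ → ℂ} (hW : IntervalIntegrable W MeasureTheory.volume α β) {τ : ℝ → ℂ}
    (hτ : ContinuousOn τ (Set.Icc α β)) (hr : r < 1) (hτr : ∀ t ∈ Set.Icc α β, ‖τ t‖ ≤ r) :
    HasSum (fun n : ℕ => g n * ∫ t in α..β, W t * τ t ^ n) (∫ t in α..β, W t * G (τ t)) := by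
  have hr0 : 0 ≤ r := (norm_nonneg _).trans (hτr α ⟨le_rfl, hαβ⟩)
  have hint : ∀ n : ℕ, MeasureTheory.Integrable (fun t : ℝ => W t * (τ t ^ n * g n))
      (MeasureTheory.volume.restrict (Set.Ioc α β)) := fun n =>
    (hW.mul_continuousOn (g := fun t : ℝ => τ t ^ n * g n) (by
      rw [Set.uIcc_of_le hαβ]; fun_prop)).1
  have hsum : Summable fun n : ℕ => ∫ t in Set.Ioc α β, ‖W t * (τ t ^ n * g n)‖ := by
    refine Summable.of_nonneg_of_le
      (fun n => MeasureTheory.integral_nonneg fun t => norm_nonneg _) (fun n => ?_)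
      ((hg.norm_bound hr0 hr).mul_left (∫ t in Set.Ioc α β, ‖W t‖))
    rw [← MeasureTheory.integral_mul_const]
    refine MeasureTheory.setIntegral_mono_on (hint n).norm (hW.1.norm.mul_const _)
      measurableSet_Ioc fun t ht => ?_
    rw [norm_mul, norm_mul, norm_pow]
    gcongr
    exact hτr t (Set.Ioc_subset_Icc_self ht)
  have key := MeasureTheory.hasSum_integral_of_summable_integral_norm hint hsum
  have h3 : ∫ t in Set.Ioc α β, ∑' n : ℕ, W t * (τ t ^ n * g n) =
      ∫ t in α..β, W t * G (τ t) := by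
    rw [intervalIntegral.integral_of_le hαβ]
    refine MeasureTheory.setIntegral_congr_fun measurableSet_Ioc fun t ht => ?_
    exact ((hg _ ((hτr t (Set.Ioc_subset_Icc_self ht)).trans_lt hr)).mul_left _).tsum_eq
  rw [h3] at key
  refine key.congr_fun fun n => ?_
  rw [← intervalIntegral.integral_of_le hαβ, ← intervalIntegral.integral_const_mul]
  congr 1
  funext t
  ring

theorem cpow_add_natCast_sub_one {t : ℝ} (ht : 0 < t) (s : ℂ) (n : ℕ) :
    (t : ℂ) ^ (s + n - 1) = (t : ℂ) ^ (s - 1) * (t : ℂ) ^ n := by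
  have ht0 : (t : ℂ) ≠ 0 := by exact_mod_cast ht.ne'
  rw [show s + n - 1 = (s - 1) + n by ring, Complex.cpow_add _ _ ht0, Complex.cpow_natCast]

theorem IsPowerSum.hasSum_integral_cpow {g : ℕ → ℂ} {G : ℂ → ℂ} (hg : IsPowerSum g G) {s : ℂ}
    (hs : 0 < s.re) {δ : ℝ} (h0 : 0 < δ) (h1 : δ < 1) :
    HasSum (fun n : ℕ => g n * ((δ : ℂ) ^ (s + n) / (s + n)))
      (∫ t in (0 : ℝ)..δ, (t : ℂ) ^ (s - 1) * G t) := by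
  refine (hg.hasSum_integral h0.le (W := fun t : ℝ => (t : ℂ) ^ (s - 1)) (τ := fun t : ℝ => (t : ℂ))
    (intervalIntegral.intervalIntegrable_cpow' (by simpa using hs)) (by fun_prop) h1
    fun t ht => by simpa [abs_of_nonneg ht.1] using ht.2).congr_fun fun n => ?_
  have h4 : ∫ t in (0 : ℝ)..δ, (t : ℂ) ^ (s - 1) * (t : ℂ) ^ n =
      ∫ t in (0 : ℝ)..δ, (t : ℂ) ^ (s + n - 1) := by
    refine intervalIntegral.integral_congr_ae (Eventually.of_forall fun t ht => ?_)
    rw [Set.uIoc_of_le h0.le] at ht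
    rw [cpow_add_natCast_sub_one ht.1]
  have hsn : s + n ≠ 0 := fun h => re_ne_neg_natCast hs n (eq_neg_of_add_eq_zero_left h)
  rw [h4, integral_cpow (Or.inl ?_)]
  · rw [sub_add_cancel, Complex.ofReal_zero, Complex.zero_cpow hsn, sub_zero]
  · simp only [Complex.sub_re, Complex.add_re, Complex.natCast_re, Complex.one_re]
    have hk : (0 : ℝ) ≤ n := n.cast_nonneg
    linarith

theorem hasDerivAt_ofReal_cpow_comp {f : ℝ → ℝ} {f' : ℝ} {t : ℝ} (hf : HasDerivAt f f' t)
    (h0 : 0 < f t) (s : ℂ) :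
    HasDerivAt (fun t : ℝ => (f t : ℂ) ^ s) (s * (f t : ℂ) ^ (s - 1) * f') t := by
  have h := (hasDerivAt_id (f t : ℂ)).cpow_const (c := s) (Or.inl (by simpa using h0))
  refine (h.comp t hf.ofReal_comp).congr_deriv ?_
  simp

theorem isPowerSum_one_add_cpow (a : ℂ) :
    IsPowerSum (fun n => (-1) ^ n * (poch a n / n !)) (fun z => (1 + z) ^ (-a)) := fun z hz => by
  have h := isPowerSum_one_sub_cpow a (-z) (by simpa using hz)
  beta_reduce at h
  rw [sub_neg_eq_add] at h
  refine h.congr_fun fun n => ?_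
  simp only [smul_eq_mul]
  rw [neg_pow]
  ring

/-! ### Incomplete beta integrals over `[δ, 1]` -/

section FirstKind

/-- The part over `[δ, 1]` of the beta integral. -/
noncomputable def betaTail (γ : ℂ) (δ : ℝ) (s : ℂ) : ℂ :=
  ∫ t in δ..1, (t : ℂ) ^ (s - 1) * (1 - (t : ℂ)) ^ (γ - 1)

theorem intervalIntegrable_betaTail {γ : ℂ} (hγ : 0 < γ.re) {δ : ℝ} (h0 : 0 < δ) (h1 : δ < 1)
    (s : ℂ) : IntervalIntegrable (fun t : ℝ => (t : ℂ) ^ (s - 1) * (1 - (t : ℂ)) ^ (γ - 1))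
      MeasureTheory.volume δ 1 := by
  have hw := (Complex.betaIntegral_convergent (u := 1) (v := γ) (by simp) hγ).mono_set
    (c := δ) (d := 1) (by
      rw [Set.uIcc_of_le h1.le, Set.uIcc_of_le zero_le_one]
      exact Set.Icc_subset_Icc_left h0.le)
  simp only [sub_self, Complex.cpow_zero, one_mul] at hw
  refine hw.continuousOn_mul (fun t ht => ?_)
  rw [Set.uIcc_of_le h1.le] at ht
  have h := (hasDerivAt_ofReal_cpow_comp (hasDerivAt_id t) (h0.trans_le ht.1) (s - 1))
  exact h.continuousAt.continuousWithinAt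

/-- Integrate the derivative of `t^s (1 - t)^γ` over `[δ, 1]`; the boundary term at `1` vanishes
because `Re γ > 0`. -/
theorem betaTail_recurrence {γ : ℂ} (hγ : 0 < γ.re) {δ : ℝ} (h0 : 0 < δ) (h1 : δ < 1) (s : ℂ) :
    s * betaTail γ δ s - (s + γ) * betaTail γ δ (s + 1) = -((δ : ℂ) ^ s * (1 - (δ : ℂ)) ^ γ) := by
  have i1 := intervalIntegrable_betaTail hγ h0 h1 s
  have i2 := intervalIntegrable_betaTail hγ h0 h1 (s + 1)
  have hγ0 : γ ≠ 0 := fun h => by simp [h] at hγ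
  have key := intervalIntegral.integral_eq_sub_of_hasDerivAt_of_le h1.le
    (f := fun t : ℝ => (t : ℂ) ^ s * (1 - (t : ℂ)) ^ γ)
    (f' := fun t : ℝ => s * ((t : ℂ) ^ (s - 1) * (1 - (t : ℂ)) ^ (γ - 1)) -
      (s + γ) * ((t : ℂ) ^ (s + 1 - 1) * (1 - (t : ℂ)) ^ (γ - 1))) ?_ ?_ ?_
  · rw [intervalIntegral.integral_sub (i1.const_mul s) (i2.const_mul (s + γ)),
      intervalIntegral.integral_const_mul, intervalIntegral.integral_const_mul] at key
    rw [betaTail, betaTail, key]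
    simp [Complex.zero_cpow hγ0]
  · intro t ht
    have h2 := (hasDerivAt_ofReal_cpow_comp (hasDerivAt_id t) (h0.trans_le ht.1) s).continuousAt
    have h3 : ContinuousAt (fun t : ℝ => (((1 - t : ℝ) : ℂ)) ^ γ) t :=
      (Complex.continuousAt_ofReal_cpow_const (1 - t) γ (Or.inl hγ)).comp (f := fun t : ℝ => 1 - t)
        (by fun_prop)
    simp only [Complex.ofReal_sub, Complex.ofReal_one] at h3
    exact (h2.mul h3).continuousWithinAt
  · intro t ht
    have ht0 : 0 < t := h0.trans ht.1
    have ht1 : 0 < 1 - t := sub_pos.2 ht.2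
    have h2 := hasDerivAt_ofReal_cpow_comp (hasDerivAt_id t) ht0 s
    have h3 := hasDerivAt_ofReal_cpow_comp ((hasDerivAt_id t).const_sub 1) ht1 γ
    have h4 := h2.mul h3
    simp only [id, Complex.ofReal_sub, Complex.ofReal_one, Complex.ofReal_neg] at h4
    refine h4.congr_deriv ?_
    have e0 : (t : ℂ) ≠ 0 := by exact_mod_cast ht0.ne'
    have e1 : (1 - (t : ℂ)) ≠ 0 := by exact_mod_cast ht1.ne'
    rw [add_sub_cancel_right]
    have e2 : (t : ℂ) ^ s = (t : ℂ) ^ (s - 1) * t := by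
      rw [Complex.cpow_sub _ _ e0, Complex.cpow_one, div_mul_cancel₀ _ e0]
    have e3 : (1 - (t : ℂ)) ^ γ = (1 - (t : ℂ)) ^ (γ - 1) * (1 - t) := by
      rw [Complex.cpow_sub _ _ e1, Complex.cpow_one, div_mul_cancel₀ _ e1]
    rw [e3, e2]
    ring
  · exact (i1.const_mul s).sub (i2.const_mul (s + γ))

/-- For `Re s > 0` the series is the termwise integral over `[0, δ]`, the complement of the tail in
the beta integral. It still makes sense when that integral diverges, and both sides obey the same
recurrence in `s`, which carries the identity to the left. -/
theorem hasSum_betaTail {γ : ℂ} (hγ : 0 < γ.re) {δ : ℝ} (h0 : 0 < δ) (h1 : δ < 1) {s : ℂ}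
    (hs : ∀ n : ℕ, s ≠ -(n : ℂ)) :
    HasSum (fun l : ℕ => poch (1 - γ) l / l ! * ((δ : ℂ) ^ (s + l) / (s + l)))
      (Complex.Gamma s * Complex.Gamma γ * (Complex.Gamma (s + γ))⁻¹ - betaTail γ δ s) := by
  obtain ⟨n, hn⟩ := exists_nat_gt (-s.re)
  have hn : 0 < s.re + n := by linarith
  induction n generalizing s with
  | zero =>
    have hs0 : 0 < s.re := by simpa using hn
    have h := (isPowerSum_one_sub_cpow (1 - γ)).hasSum_integral_cpow hs0 h0 h1
    convert! h using 1
    have hb := Complex.betaIntegral_eq_Gamma_mul_div s γ hs0 hγ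
    rw [Complex.betaIntegral, ← intervalIntegral.integral_add_adjacent_intervals (b := δ)] at hb
    · rw [← div_eq_mul_inv, ← hb, betaTail]
      simp
    · refine (Complex.betaIntegral_convergent hs0 hγ).mono_set ?_
      rw [Set.uIcc_of_le h0.le, Set.uIcc_of_le zero_le_one]
      exact Set.Icc_subset_Icc_right h1.le
    · exact intervalIntegrable_betaTail hγ h0 h1 s
  | succ n ih =>
    have hs0 : s ≠ 0 := by simpa using hs 0
    have hs1 : ∀ n : ℕ, s + 1 ≠ -(n : ℂ) := fun n hn => hs (n + 1) (by
      push_cast; linear_combination hn)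
    have h := ih hs1 (by
      have : (s + 1).re = s.re + 1 := by simp
      push_cast at hn; linarith) (by
      have : (s + 1).re = s.re + 1 := by simp
      push_cast at hn; linarith)
    have hd : ‖(δ : ℂ)‖ < 1 := by simpa [abs_of_pos h0] using h1
    have hδ : (δ : ℂ) ≠ 0 := by exact_mod_cast h0.ne'
    have hp := ((isPowerSum_one_sub_cpow (-γ)) δ hd).mul_left ((δ : ℂ) ^ s)
    rw [neg_neg] at hp
    -- The series for `s` is `s⁻¹` times the sum of `s + γ` times the series for `s + 1`, moved by
    -- one place, and the expansion of the boundary term `δ^s (1 - δ)^γ`. Termwise this rests on `(s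
    -- + γ)(l + 1) - γ(s + 1 + l) = s(l + 1 - γ)`.
    have hsh := HasSum.zero_add (f := shift (fun l : ℕ =>
      poch (1 - γ) l / l ! * ((δ : ℂ) ^ (s + 1 + l) / (s + 1 + l)))) h
    have hr := betaTail_recurrence hγ h0 h1 s
    have hf := ((hsh.mul_left (s + γ)).add hp).mul_left s⁻¹
    convert! hf using 1
    · funext l
      cases l with
      | zero => simp [shift]; field_simp
      | succ l =>
        have hl : s + 1 + l ≠ 0 := fun h => hs1 l (eq_neg_of_add_eq_zero_left h)
        have hf : ((l ! : ℕ) : ℂ) ≠ 0 := by exact_mod_cast l.factorial_ne_zero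
        have hl1 : (l : ℂ) + 1 ≠ 0 := by exact_mod_cast l.succ_ne_zero
        have e : (δ : ℂ) ^ (s + (l + 1 : ℕ)) = δ ^ s * δ ^ (l + 1) := by
          rw [Complex.cpow_add _ _ hδ, Complex.cpow_natCast]
        have e' : s + 1 + l = s + (l + 1 : ℕ) := by push_cast; ring
        simp only [shift, smul_eq_mul]
        rw [e', e, ← e', poch_succ, poch_succ_left (-γ), show -γ + 1 = 1 - γ by ring,
          Nat.factorial_succ]
        push_cast
        field_simp
        ring
    · have hG : Complex.Gamma s = Complex.Gamma (s + 1) / s := by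
        rw [Complex.Gamma_add_one s hs0]; field_simp
      have hG2 := Complex.one_div_Gamma_eq_self_mul_one_div_Gamma_add_one (s + γ)
      rw [show s + 1 + γ = s + γ + 1 by ring, hG2, hG, eq_inv_mul_iff_mul_eq₀ hs0]
      simp only [shift, zero_add]
      field_simp
      linear_combination -hr

end FirstKind

/-! ### Incomplete beta integrals of the second kind over `[0, ρ]` -/

section SecondKind

/-- The part over `[0, ρ]` of the beta integral of the second kind. -/
noncomputable def betaHead (s : ℂ) (ρ : ℝ) (a : ℂ) : ℂ :=
  ∫ u in (0 : ℝ)..ρ, (u : ℂ) ^ (s - 1) * (1 + (u : ℂ)) ^ (-a)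

theorem continuousAt_one_add_cpow (a : ℂ) {u : ℝ} (hu : 0 ≤ u) :
    ContinuousAt (fun u : ℝ => (1 + (u : ℂ)) ^ a) u := by
  have h := (hasDerivAt_ofReal_cpow_comp ((hasDerivAt_id u).const_add 1) (show 0 < 1 + u by linarith)
    a).continuousAt
  simpa using h

theorem intervalIntegrable_betaHead {s : ℂ} (hs : 0 < s.re) {ρ : ℝ} (h0 : 0 ≤ ρ) (a : ℂ) :
    IntervalIntegrable (fun u : ℝ => (u : ℂ) ^ (s - 1) * (1 + (u : ℂ)) ^ (-a))
      MeasureTheory.volume 0 ρ := by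
  refine (intervalIntegral.intervalIntegrable_cpow' (by simpa using hs)).mul_continuousOn
    fun u hu => ?_
  rw [Set.uIcc_of_le h0] at hu
  exact (continuousAt_one_add_cpow _ hu.1).continuousWithinAt

theorem betaHead_recurrence {s : ℂ} (hs : 0 < s.re) {ρ : ℝ} (h0 : 0 ≤ ρ) (a : ℂ) :
    (s - a) * betaHead s ρ a + a * betaHead s ρ (a + 1) = (ρ : ℂ) ^ s * (1 + (ρ : ℂ)) ^ (-a) := by
  have i1 := intervalIntegrable_betaHead hs h0 a
  have i2 := intervalIntegrable_betaHead hs h0 (a + 1)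
  have hs0 : s ≠ 0 := fun h => by simp [h] at hs
  have key := intervalIntegral.integral_eq_sub_of_hasDerivAt_of_le h0
    (f := fun t : ℝ => (t : ℂ) ^ s * (1 + (t : ℂ)) ^ (-a))
    (f' := fun t : ℝ => (s - a) * ((t : ℂ) ^ (s - 1) * (1 + (t : ℂ)) ^ (-a)) +
      a * ((t : ℂ) ^ (s - 1) * (1 + (t : ℂ)) ^ (-(a + 1)))) ?_ ?_ ?_
  · rw [intervalIntegral.integral_add (i1.const_mul (s - a)) (i2.const_mul a),
      intervalIntegral.integral_const_mul, intervalIntegral.integral_const_mul] at key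
    rw [betaHead, betaHead, key]
    simp [Complex.zero_cpow hs0]
  · intro t ht
    exact ((Complex.continuousAt_ofReal_cpow_const t s (Or.inl hs)).mul
      (continuousAt_one_add_cpow _ ht.1)).continuousWithinAt
  · intro t ht
    have ht1 : 0 < 1 + t := by linarith [ht.1]
    have h2 := hasDerivAt_ofReal_cpow_comp (hasDerivAt_id t) ht.1 s
    have h3 := hasDerivAt_ofReal_cpow_comp ((hasDerivAt_id t).const_add 1) ht1 (-a)
    have h4 := h2.mul h3
    simp only [id, Complex.ofReal_add, Complex.ofReal_one] at h4
    refine h4.congr_deriv ?_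
    have e0 : (t : ℂ) ≠ 0 := by exact_mod_cast ht.1.ne'
    have e1 : (1 + (t : ℂ)) ≠ 0 := by exact_mod_cast ht1.ne'
    have e2 : (t : ℂ) ^ s = (t : ℂ) ^ (s - 1) * t := by
      rw [Complex.cpow_sub _ _ e0, Complex.cpow_one, div_mul_cancel₀ _ e0]
    have e3 : (1 + (t : ℂ)) ^ (-a) = (1 + (t : ℂ)) ^ (-(a + 1)) * (1 + t) := by
      rw [show -(a + 1) = -a - 1 by ring, Complex.cpow_sub _ _ e1, Complex.cpow_one,
        div_mul_cancel₀ _ e1]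
    rw [show -a - 1 = -(a + 1) by ring, e3, e2]
    ring
  · exact (i1.const_mul (s - a)).add (i2.const_mul a)

/-- The substitution `w = u / (1 + u)`, which turns the half-line into `[0, 1)`. -/
theorem betaHead_eq {s a : ℂ} (hs : 0 < s.re) (hsa : s.re < a.re) {ρ : ℝ} (h0 : 0 < ρ) :
    betaHead s ρ a =
      ∫ w in (0 : ℝ)..(ρ / (1 + ρ)), (w : ℂ) ^ (s - 1) * (1 - (w : ℂ)) ^ (a - s - 1) := by
  have hbc := Complex.betaIntegral_convergent (u := s) (v := a - s) hs (by simpa using hsa)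
  have hpt : ∀ u : ℝ, 0 < u → ((1 / (1 + u) ^ 2 : ℝ)) •
      ((((u / (1 + u) : ℝ) : ℂ)) ^ (s - 1) * (1 - ((u / (1 + u) : ℝ) : ℂ)) ^ (a - s - 1)) =
      (u : ℂ) ^ (s - 1) * (1 + (u : ℂ)) ^ (-a) := by
    intro u hu
    have hv : 0 < 1 + u := by linarith
    have e1 : (1 + (u : ℂ)) ≠ 0 := by exact_mod_cast hv.ne'
    have e2 : (1 : ℂ) - ((u / (1 + u) : ℝ) : ℂ) = (((1 + u)⁻¹ : ℝ) : ℂ) := by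
      push_cast; field_simp; ring
    have e3 : ∀ z : ℂ, (((1 + u)⁻¹ : ℝ) : ℂ) ^ z = (1 + (u : ℂ)) ^ (-z) := fun z => by
      rw [Complex.ofReal_inv, Complex.inv_cpow, ← Complex.cpow_neg]
      · push_cast; rfl
      · rw [Complex.arg_ofReal_of_nonneg hv.le]; exact Real.pi_pos.ne
    rw [e2, div_eq_mul_inv u, Complex.ofReal_mul,
      Complex.mul_cpow_ofReal_nonneg hu.le (by positivity), e3, e3, Complex.real_smul]
    have e4 : (1 + (u : ℂ)) ^ (-a) = (1 + (u : ℂ)) ^ (-(s - 1)) * (1 + (u : ℂ)) ^ (-(a - s - 1)) *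
        (1 + (u : ℂ)) ^ (-2 : ℂ) := by
      rw [← Complex.cpow_add _ _ e1, ← Complex.cpow_add _ _ e1]
      congr 1
      ring
    have e5 : (1 + (u : ℂ)) ^ (-2 : ℂ) = ((1 / (1 + u) ^ 2 : ℝ) : ℂ) := by
      rw [Complex.cpow_neg, show (2 : ℂ) = ((2 : ℕ) : ℂ) by norm_num, Complex.cpow_natCast]
      push_cast
      rw [one_div]
    rw [e4, e5]
    ring
  have key := intervalIntegral.integral_deriv_smul_comp''' (a := 0) (b := ρ)
    (f := fun u : ℝ => u / (1 + u)) (f' := fun u => 1 / (1 + u) ^ 2)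
    (g := fun w : ℝ => (w : ℂ) ^ (s - 1) * (1 - (w : ℂ)) ^ (a - s - 1)) ?_ ?_ ?_ ?_ ?_
  · simp only [zero_div] at key
    rw [← key, betaHead]
    refine intervalIntegral.integral_congr_ae (Eventually.of_forall fun u hu => ?_)
    rw [Set.uIoc_of_le h0.le] at hu
    exact (hpt u hu.1).symm
  · rw [Set.uIcc_of_le h0.le]
    refine ContinuousOn.div (by fun_prop) (by fun_prop) fun u hu => ?_
    linarith [hu.1]
  · intro u hu
    rw [min_eq_left h0.le] at hu
    have hv : 1 + u ≠ 0 := by linarith [hu.1]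
    refine (((hasDerivAt_id u).div ((hasDerivAt_id u).const_add 1) hv).congr_deriv ?_).hasDerivWithinAt
    simp
  · rintro _ ⟨u, hu, rfl⟩
    rw [min_eq_left h0.le] at hu
    have hu0 : 0 < u := hu.1
    have hw : 0 < u / (1 + u) := by positivity
    have hw1 : 0 < 1 - u / (1 + u) := by
      rw [sub_pos, div_lt_one (by positivity)]; linarith
    have h2 := (hasDerivAt_ofReal_cpow_comp (hasDerivAt_id (u / (1 + u))) hw (s - 1)).continuousAt
    have h3 := (hasDerivAt_ofReal_cpow_comp ((hasDerivAt_id (u / (1 + u))).const_sub 1) hw1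
      (a - s - 1)).continuousAt
    have h4 := h2.mul h3
    simp only [id, Complex.ofReal_sub, Complex.ofReal_one] at h4
    exact h4.continuousWithinAt
  · rw [intervalIntegrable_iff_integrableOn_Icc_of_le zero_le_one] at hbc
    refine hbc.mono_set ?_
    rintro _ ⟨u, hu, rfl⟩
    rw [Set.uIcc_of_le h0.le] at hu
    have hu0 : 0 ≤ u := hu.1
    exact ⟨by positivity, by rw [div_le_one (by positivity)]; linarith⟩
  · rw [Set.uIcc_of_le h0.le, integrableOn_Icc_iff_integrableOn_Ioc]
    refine MeasureTheory.IntegrableOn.congr_fun (intervalIntegrable_betaHead hs h0.le a).1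
      (fun u hu => (hpt u hu.1).symm) measurableSet_Ioc

/-- The series is the regularized integral over `[ρ, ∞)`: under `u = 1 / t` it becomes an integral
over `[0, ρ⁻¹]`, inside the unit disc since `ρ > 1`. When `Re a ≤ Re s` the integral diverges and
the recurrence in `a` continues the identity. -/
theorem hasSum_betaHead {s : ℂ} (hs : 0 < s.re) {ρ : ℝ} (h1 : 1 < ρ) {a : ℂ}
    (ha : ∀ n : ℕ, a - s ≠ -(n : ℂ)) :
    HasSum (fun k : ℕ => (-1) ^ k * (poch a k / k !) *
        (((ρ⁻¹ : ℝ) : ℂ) ^ (a - s + k) / (a - s + k)))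
      (Complex.Gamma s * Complex.Gamma (a - s) * (Complex.Gamma a)⁻¹ - betaHead s ρ a) := by
  have h0 : 0 < ρ := zero_lt_one.trans h1
  have hi0 : 0 < ρ⁻¹ := inv_pos.2 h0
  have hi1 : ρ⁻¹ < 1 := inv_lt_one_of_one_lt₀ h1
  obtain ⟨n, hn⟩ := exists_nat_gt (-(a - s).re)
  have hn : 0 < (a - s).re + n := by linarith
  induction n generalizing a with
  | zero =>
    have hs0 : 0 < (a - s).re := by simpa using hn
    have hsa : s.re < a.re := by simpa using hs0
    have h := (isPowerSum_one_add_cpow a).hasSum_integral_cpow hs0 hi0 hi1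
    convert! h using 1
    have hb := Complex.betaIntegral_eq_Gamma_mul_div s (a - s) hs hs0
    have h2 : ∫ t in (0 : ℝ)..ρ⁻¹, (t : ℂ) ^ (a - s - 1) * (1 + (t : ℂ)) ^ (-a) =
        betaHead (a - s) ρ⁻¹ a := rfl
    -- The substitution sends the end points `ρ⁻¹` and `ρ` to complementary points of `[0, 1]`, so
    -- after `w ↦ 1 - w` the two pieces join to the full beta integral.
    have hd : 0 < 1 + ρ := by linarith
    have hq : ρ⁻¹ / (1 + ρ⁻¹) = 1 - ρ / (1 + ρ) := by field_simp; ring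
    have h3 : ∫ w in (0 : ℝ)..(1 - ρ / (1 + ρ)),
          (w : ℂ) ^ (a - s - 1) * (1 - (w : ℂ)) ^ (s - 1) =
        ∫ w in (ρ / (1 + ρ))..1, (w : ℂ) ^ (s - 1) * (1 - (w : ℂ)) ^ (a - s - 1) := by
      have := intervalIntegral.integral_comp_sub_left (a := ρ / (1 + ρ)) (b := 1)
        (fun w : ℝ => (w : ℂ) ^ (a - s - 1) * (1 - (w : ℂ)) ^ (s - 1)) 1
      rw [sub_self] at this
      rw [← this]
      refine intervalIntegral.integral_congr fun w _ => ?_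
      simp only [Complex.ofReal_sub, Complex.ofReal_one, sub_sub_cancel]
      ring
    have hbc := Complex.betaIntegral_convergent hs hs0
    have hr0 : 0 ≤ ρ / (1 + ρ) := by positivity
    have hr1 : ρ / (1 + ρ) ≤ 1 := by rw [div_le_one hd]; linarith
    rw [h2, betaHead_eq hs0 (by simp [hs]) hi0, betaHead_eq hs hsa h0, hq,
      show a - (a - s) - 1 = s - 1 by ring, h3, ← div_eq_mul_inv]
    rw [add_sub_cancel] at hb
    rw [← hb, Complex.betaIntegral,
      ← intervalIntegral.integral_add_adjacent_intervals (b := ρ / (1 + ρ))]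
    · ring
    · refine hbc.mono_set ?_
      rw [Set.uIcc_of_le hr0, Set.uIcc_of_le zero_le_one]
      exact Set.Icc_subset_Icc_right hr1
    · refine hbc.mono_set ?_
      rw [Set.uIcc_of_le hr1, Set.uIcc_of_le zero_le_one]
      exact Set.Icc_subset_Icc_left hr0
  | succ n ih =>
    have hs0 : a - s ≠ 0 := by simpa using ha 0
    have ha1 : ∀ n : ℕ, a + 1 - s ≠ -(n : ℂ) := fun n hn => ha (n + 1) (by
      push_cast; linear_combination hn)
    have hre : (a + 1 - s).re = (a - s).re + 1 := by simp; ring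
    have h := ih ha1 (by push_cast at hn; linarith) (by push_cast at hn; linarith)
    have hd : ‖((ρ⁻¹ : ℝ) : ℂ)‖ < 1 := by
      rw [Complex.norm_real, Real.norm_of_nonneg hi0.le]; exact hi1
    have hδ : ((ρ⁻¹ : ℝ) : ℂ) ≠ 0 := by exact_mod_cast hi0.ne'
    have hp := ((isPowerSum_one_add_cpow a) _ hd).mul_left (((ρ⁻¹ : ℝ) : ℂ) ^ (a - s))
    have hbd : ((ρ⁻¹ : ℝ) : ℂ) ^ (a - s) * (1 + ((ρ⁻¹ : ℝ) : ℂ)) ^ (-a) =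
        (ρ : ℂ) ^ s * (1 + (ρ : ℂ)) ^ (-a) := by
      have hρ : (ρ : ℂ) ≠ 0 := by exact_mod_cast h0.ne'
      have e1 : (1 + (ρ : ℂ)) = ((ρ : ℝ) : ℂ) * ((1 + ρ⁻¹ : ℝ) : ℂ) := by
        push_cast; field_simp; ring
      rw [e1, Complex.mul_cpow_ofReal_nonneg h0.le (by positivity), ← mul_assoc,
        ← Complex.cpow_add _ _ hρ, Complex.ofReal_inv, Complex.inv_cpow, ← Complex.cpow_neg]
      · push_cast; congr 2; ring
      · rw [Complex.arg_ofReal_of_nonneg h0.le]; exact Real.pi_pos.ne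
    rw [hbd] at hp
    have hsh := HasSum.zero_add (f := shift (fun k : ℕ => (-1) ^ k * (poch (a + 1) k / k !) *
        (((ρ⁻¹ : ℝ) : ℂ) ^ (a + 1 - s + k) / (a + 1 - s + k)))) h
    have hr := betaHead_recurrence hs h0.le a
    have hf := ((hsh.mul_left a).add hp).mul_left (a - s)⁻¹
    convert! hf using 1
    · funext l
      cases l with
      | zero => simp [shift]; field_simp
      | succ l =>
        have hl : a + 1 - s + l ≠ 0 := fun h => ha1 l (eq_neg_of_add_eq_zero_left h)
        have hf : ((l ! : ℕ) : ℂ) ≠ 0 := by exact_mod_cast l.factorial_ne_zero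
        have hl1 : (l : ℂ) + 1 ≠ 0 := by exact_mod_cast l.succ_ne_zero
        have e : ((ρ⁻¹ : ℝ) : ℂ) ^ (a - s + (l + 1 : ℕ)) =
            ((ρ⁻¹ : ℝ) : ℂ) ^ (a - s) * ((ρ⁻¹ : ℝ) : ℂ) ^ (l + 1) := by
          rw [Complex.cpow_add _ _ hδ, Complex.cpow_natCast]
        have e' : a + 1 - s + l = a - s + (l + 1 : ℕ) := by push_cast; ring
        simp only [shift, smul_eq_mul]
        rw [e', e, ← e', poch_succ_left, Nat.factorial_succ, pow_succ (-1 : ℂ)]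
        push_cast
        generalize ((ρ : ℂ)⁻¹) ^ (a - s) = P
        generalize ((ρ : ℂ)⁻¹) ^ (l + 1) = Q
        field_simp
        ring
    · have hG : Complex.Gamma (a - s) = Complex.Gamma (a + 1 - s) / (a - s) := by
        rw [show a + 1 - s = a - s + 1 by ring, Complex.Gamma_add_one _ hs0]; field_simp
      have hG2 := Complex.one_div_Gamma_eq_self_mul_one_div_Gamma_add_one a
      rw [hG2, hG, eq_inv_mul_iff_mul_eq₀ hs0]
      simp only [shift, zero_add]
      field_simp
      linear_combination hr

end SecondKind

/-! ### The connection formula for the Gauss series: Euler integral on the negative axis -/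

theorem Gamma_inv_sub_nat (z : ℂ) (n : ℕ) :
    (Complex.Gamma (z - n))⁻¹ = (-1) ^ n * poch (1 - z) n * (Complex.Gamma z)⁻¹ := by
  rw [Gamma_inv_eq_poch_mul (z - n) n, poch_sub_self, sub_add_cancel]

theorem Gamma_sub_nat {z : ℂ} (hz : ∀ n : ℤ, z ≠ n) (n : ℕ) :
    Complex.Gamma (z - n) = (-1) ^ n * Complex.Gamma z / poch (1 - z) n := by
  have h1 : ∀ k : ℕ, z - n ≠ -(k : ℂ) := fun k hk => hz (n - k) (by
    push_cast; linear_combination hk)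
  have h2 : ∀ k : ℕ, 1 - z ≠ -(k : ℂ) := fun k hk => hz (k + 1) (by
    push_cast; linear_combination -hk)
  have h := Gamma_add_nat h1 n
  rw [sub_add_cancel, poch_sub_self] at h
  rw [h, eq_div_iff (poch_ne_zero h2 n)]
  have h3 : ((-1 : ℂ) ^ n) * (-1) ^ n = 1 := by rw [← mul_pow]; simp
  linear_combination (-Complex.Gamma (z - n) * poch (1 - z) n) * h3

/-- A non-integer has positive distance from `ℤ`. This controls the denominators `b - a - k + l` of
the cross terms uniformly in both indices. -/
theorem exists_lower_bound_add_int {z : ℂ} (hz : ∀ n : ℤ, z ≠ n) :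
    ∃ ε > 0, ∀ n : ℤ, ε ≤ ‖z + n‖ := by
  by_cases him : z.im = 0
  · refine ⟨min (Int.fract z.re) (1 - Int.fract z.re), ?_, fun n => ?_⟩
    · refine lt_min ?_ (sub_pos.2 (Int.fract_lt_one _))
      refine lt_of_le_of_ne (Int.fract_nonneg _) fun h => hz ⌊z.re⌋ ?_
      apply Complex.ext
      · have := Int.fract_add_floor z.re
        rw [← h, zero_add] at this
        simp [this]
      · simp [him]
    · refine le_trans ?_ (Complex.abs_re_le_norm _)
      simp only [Complex.add_re, Complex.intCast_re]
      have h1 := Int.fract_add_floor z.re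
      have h2 := Int.fract_nonneg z.re
      have h3 := Int.fract_lt_one z.re
      rcases le_or_gt 0 (⌊z.re⌋ + n) with h | h
      · have h' : (0 : ℝ) ≤ ⌊z.re⌋ + n := by exact_mod_cast h
        refine (min_le_left _ _).trans ((le_abs_self _).trans' ?_)
        linarith
      · have h' : (⌊z.re⌋ : ℝ) + n ≤ -1 := by exact_mod_cast Int.le_sub_one_of_lt h
        refine (min_le_right _ _).trans ((neg_le_abs _).trans' ?_)
        linarith
  · refine ⟨|z.im|, abs_pos.2 him, fun n => ?_⟩
    refine le_trans ?_ (Complex.abs_im_le_norm _)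
    simp

/-- The combination of the two solutions at infinity in the connection formula. -/
noncomputable def connSum (a b c x : ℂ) : ℂ :=
  connCoeff c b a * (-x) ^ (-a) * ordinaryHypergeometric (1 - c + a) a (1 - b + a) (1 / x) +
  connCoeff c a b * (-x) ^ (-b) * ordinaryHypergeometric (1 - c + b) b (1 - a + b) (1 / x)

/-! ### Euler's integral at `x = -X`, cut at `t = 1/2` -/

section Split

variable {a b γ : ℂ} {X : ℝ}

/-- On `[0, 1/2]` the binomial series of `(1 - t)^(γ - 1)` converges uniformly; the scaling `u = X
t` turns each term into an incomplete integral of the second kind. -/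
theorem hasSum_integral_left (hb : 0 < b.re) (hX : 0 < X) :
    HasSum (fun l : ℕ => poch (1 - γ) l / l ! *
        ((X : ℂ) ^ (-(b + l)) * betaHead (b + l) (X / 2) a))
      (∫ t in (0 : ℝ)..(1 / 2), (t : ℂ) ^ (b - 1) * (1 - (t : ℂ)) ^ (γ - 1) *
        (1 + X * (t : ℂ)) ^ (-a)) := by
  have hcont : ContinuousOn (fun t : ℝ => (1 + X * (t : ℂ)) ^ (-a)) (Set.uIcc 0 (1 / 2)) := by
    intro t ht
    rw [Set.uIcc_of_le (by norm_num)] at ht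
    have h := (continuousAt_one_add_cpow (-a) (mul_nonneg hX.le ht.1)).comp
      (f := fun t : ℝ => X * t) (by fun_prop)
    simp only [Complex.ofReal_mul, Function.comp_def] at h
    exact h.continuousWithinAt
  have h := (isPowerSum_one_sub_cpow (1 - γ)).hasSum_integral (α := 0) (β := 1 / 2) (r := 1 / 2)
    (by norm_num) (W := fun t : ℝ => (t : ℂ) ^ (b - 1) * (1 + X * (t : ℂ)) ^ (-a))
    (τ := fun t : ℝ => (t : ℂ))
    ((intervalIntegral.intervalIntegrable_cpow' (by simpa using hb)).mul_continuousOn hcont)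
    (by fun_prop) (by norm_num) (fun t ht => by simpa [abs_of_nonneg ht.1] using ht.2)
  convert! h using 1
  · funext l
    congr 1
    have h1 := intervalIntegral.integral_comp_mul_left (a := 0) (b := 1 / 2)
      (fun u : ℝ => (u : ℂ) ^ (b + l - 1) * (1 + (u : ℂ)) ^ (-a)) hX.ne'
    have h2 : ∫ t in (0 : ℝ)..(1 / 2),
        (((X * t : ℝ) : ℂ)) ^ (b + l - 1) * (1 + ((X * t : ℝ) : ℂ)) ^ (-a) =
        ∫ t in (0 : ℝ)..(1 / 2), (X : ℂ) ^ (b + l - 1) *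
          ((t : ℂ) ^ (b - 1) * (1 + X * (t : ℂ)) ^ (-a) * (t : ℂ) ^ l) := by
      refine intervalIntegral.integral_congr_ae (Eventually.of_forall fun t ht => ?_)
      rw [Set.uIoc_of_le (by norm_num)] at ht
      rw [Complex.ofReal_mul, Complex.mul_cpow_ofReal_nonneg hX.le ht.1.le,
        cpow_add_natCast_sub_one ht.1]
      ring
    rw [h2, intervalIntegral.integral_const_mul, mul_zero, Complex.real_smul, mul_one_div] at h1
    have hX0 : (X : ℂ) ≠ 0 := by exact_mod_cast hX.ne'
    have h3 : (X : ℂ) ^ (-(b + l)) * ((X : ℂ) * (X : ℂ) ^ (b + l - 1)) = 1 := by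
      rw [mul_comm (X : ℂ), Complex.cpow_sub _ _ hX0, Complex.cpow_one, div_mul_cancel₀ _ hX0,
        ← Complex.cpow_add _ _ hX0, neg_add_cancel, Complex.cpow_zero]
    rw [betaHead]
    have h4 : ∫ u in (0 : ℝ)..(X / 2), (u : ℂ) ^ (b + l - 1) * (1 + (u : ℂ)) ^ (-a) =
        X * ((X : ℂ) ^ (b + l - 1) * ∫ t in (0 : ℝ)..(1 / 2),
          ((t : ℂ) ^ (b - 1) * (1 + X * (t : ℂ)) ^ (-a) * (t : ℂ) ^ l)) := by
      rw [h1]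
      push_cast
      field_simp
    rw [h4]
    linear_combination (∫ t in (0 : ℝ)..(1 / 2),
          ((t : ℂ) ^ (b - 1) * (1 + X * (t : ℂ)) ^ (-a) * (t : ℂ) ^ l)) * h3
  · congr 1
    funext t
    rw [neg_sub]
    ring

/-- On `[1/2, 1]` one has `(X t)⁻¹ ≤ 2 / X < 1`, so `(1 + X t)^(-a) = (X t)^(-a) (1 + (X t)⁻¹)^(-a)`
can be expanded; this is where `X > 2` enters. -/
theorem hasSum_integral_right (hγ : 0 < γ.re) (hX : 2 < X) :
    HasSum (fun k : ℕ => (-1) ^ k * (poch a k / k !) *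
        ((X : ℂ) ^ (-a - k) * betaTail γ (1 / 2) (b - a - k)))
      (∫ t in (1 / 2 : ℝ)..1, (t : ℂ) ^ (b - 1) * (1 - (t : ℂ)) ^ (γ - 1) *
        (1 + X * (t : ℂ)) ^ (-a)) := by
  have hX0 : 0 < X := by linarith
  have hXc : (X : ℂ) ≠ 0 := by exact_mod_cast hX0.ne'
  have hW := (intervalIntegrable_betaTail hγ (δ := 1 / 2) (by norm_num) (by norm_num)
    (b - a)).const_mul ((X : ℂ) ^ (-a))
  have h := (isPowerSum_one_add_cpow a).hasSum_integral (α := 1 / 2) (β := 1) (r := 2 / X)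
    (by norm_num) hW (τ := fun t : ℝ => (((X * t)⁻¹ : ℝ) : ℂ)) ?_ ?_ ?_
  · convert! h using 1
    · funext k
      congr 1
      rw [betaTail, ← intervalIntegral.integral_const_mul]
      refine intervalIntegral.integral_congr fun t ht => ?_
      rw [Set.uIcc_of_le (by norm_num)] at ht
      have ht0 : 0 < t := by linarith [ht.1]
      have htc : (t : ℂ) ≠ 0 := by exact_mod_cast ht0.ne'
      rw [show b - a - k - 1 = (b - a - 1) - k by ring, Complex.cpow_sub _ _ htc,
        Complex.cpow_sub _ _ hXc, Complex.cpow_natCast, Complex.cpow_natCast]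
      push_cast
      rw [inv_pow, mul_pow]
      field_simp
    · refine intervalIntegral.integral_congr fun t ht => ?_
      rw [Set.uIcc_of_le (by norm_num)] at ht
      have ht0 : 0 < t := by linarith [ht.1]
      have htc : (t : ℂ) ≠ 0 := by exact_mod_cast ht0.ne'
      have e1 : (1 + X * (t : ℂ)) = ((X * t : ℝ) : ℂ) * ((1 + (X * t)⁻¹ : ℝ) : ℂ) := by
        push_cast; field_simp; ring
      rw [e1, Complex.mul_cpow_ofReal_nonneg (by positivity) (by positivity), Complex.ofReal_mul,
        Complex.mul_cpow_ofReal_nonneg hX0.le ht0.le, show b - a - 1 = (b - 1) + -a by ring,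
        Complex.cpow_add _ _ htc]
      push_cast
      ring
  · intro t ht
    have ht0 : 0 < t := by linarith [ht.1]
    refine ContinuousAt.continuousWithinAt (Complex.continuous_ofReal.continuousAt.comp ?_)
    exact ContinuousAt.inv₀ (by fun_prop) (by positivity)
  · rw [div_lt_one hX0]; exact hX
  · intro t ht
    have ht0 : 0 < t := by linarith [ht.1]
    rw [Complex.norm_real, Real.norm_of_nonneg (by positivity), inv_le_comm₀ (by positivity)
      (by positivity), inv_div, div_le_iff₀ (by norm_num)]
    nlinarith [ht.1]

/-- The terms by which the two regularizations differ; they cancel in the sum. -/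
noncomputable def crossTerm (a b γ : ℂ) (X : ℝ) (p : ℕ × ℕ) : ℂ :=
  (-1) ^ p.1 * (poch a p.1 / p.1 !) * (poch (1 - γ) p.2 / p.2 !) *
    ((X : ℂ) ^ (-a - p.1) * (((1 / 2 : ℝ) : ℂ) ^ (b - a - p.1 + p.2) / (b - a - p.1 + p.2)))

theorem summable_crossTerm (hab : ∀ n : ℤ, a - b ≠ n) (hX : 2 < X) :
    Summable (crossTerm a b γ X) := by
  obtain ⟨ε, hε, hbd⟩ := exists_lower_bound_add_int (z := b - a) fun n hn => hab (-n) (by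
    push_cast; linear_combination -hn)
  have hX0 : 0 < X := by linarith
  have hXc : (X : ℂ) ≠ 0 := by exact_mod_cast hX0.ne'
  have h1 := (isPowerSum_one_sub_cpow a).norm_bound (r := 2 / X) (by positivity)
    (by rw [div_lt_one hX0]; exact hX)
  have h2 := (isPowerSum_one_sub_cpow (1 - γ)).norm_bound (r := 1 / 2) (by norm_num) (by norm_num)
  have h3 := (h1.mul_of_nonneg h2 (fun n => by positivity) (fun n => by positivity)).mul_left
    (‖(X : ℂ) ^ (-a)‖ * ‖((1 / 2 : ℝ) : ℂ) ^ (b - a)‖ * ε⁻¹)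
  refine Summable.of_norm_bounded h3 fun p => ?_
  have hh : ((1 / 2 : ℝ) : ℂ) ≠ 0 := by norm_num
  have e1 : (X : ℂ) ^ (-a - p.1) = (X : ℂ) ^ (-a) / (X : ℂ) ^ p.1 := by
    rw [Complex.cpow_sub _ _ hXc, Complex.cpow_natCast]
  have e2 : ((1 / 2 : ℝ) : ℂ) ^ (b - a - p.1 + p.2) =
      ((1 / 2 : ℝ) : ℂ) ^ (b - a) / ((1 / 2 : ℝ) : ℂ) ^ p.1 * ((1 / 2 : ℝ) : ℂ) ^ p.2 := by
    rw [Complex.cpow_add _ _ hh, Complex.cpow_sub _ _ hh, Complex.cpow_natCast, Complex.cpow_natCast]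
  have e3 : ‖b - a - p.1 + p.2‖⁻¹ ≤ ε⁻¹ := by
    refine inv_anti₀ hε ?_
    have := hbd ((p.2 : ℤ) - p.1)
    push_cast at this
    rwa [show b - a + ((p.2 : ℂ) - p.1) = b - a - p.1 + p.2 by ring] at this
  rw [crossTerm, e1, e2]
  simp only [norm_mul, norm_div, norm_pow, norm_neg, norm_one, one_pow, one_mul, Complex.norm_real,
    Complex.norm_natCast]
  rw [Real.norm_of_nonneg hX0.le, Real.norm_of_nonneg (show (0 : ℝ) ≤ 2 by norm_num),
    div_eq_mul_inv _ ‖b - a - p.1 + p.2‖, div_pow (2 : ℝ)]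
  have e4 : ∀ k : ℕ, ((1 / 2 : ℝ) ^ k)⁻¹ = 2 ^ k := fun k => by rw [← inv_pow]; norm_num
  rw [div_eq_mul_inv _ ((1 / 2 : ℝ) ^ p.1), e4]
  calc _ = ‖(X : ℂ) ^ (-a)‖ * ‖((1 / 2 : ℝ) : ℂ) ^ (b - a)‖ * ‖b - a - p.1 + p.2‖⁻¹ *
        (2 ^ p.1 / X ^ p.1 * (‖poch a p.1‖ / p.1 !) *
          ((1 / 2) ^ p.2 * (‖poch (1 - γ) p.2‖ / p.2 !))) := by ring
    _ ≤ _ := by gcongr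

theorem integral_split (hab : ∀ n : ℤ, a - b ≠ n) (hb : 0 < b.re) (hγ : 0 < γ.re) (hX : 2 < X) :
    ∃ S T : ℂ,
      HasSum (fun k : ℕ => (-1) ^ k * (poch a k / k !) * ((X : ℂ) ^ (-a - k) *
        (Complex.Gamma (b - a - k) * Complex.Gamma γ * (Complex.Gamma (b - a - k + γ))⁻¹))) S ∧
      HasSum (fun l : ℕ => poch (1 - γ) l / l ! * ((X : ℂ) ^ (-(b + l)) *
        (Complex.Gamma (b + l) * Complex.Gamma (a - (b + l)) * (Complex.Gamma a)⁻¹))) T ∧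
      ∫ t in (0 : ℝ)..1, (t : ℂ) ^ (b - 1) * (1 - (t : ℂ)) ^ (γ - 1) *
        (1 + X * (t : ℂ)) ^ (-a) = S + T := by
  have hX0 : 0 < X := by linarith
  have hXc : (X : ℂ) ≠ 0 := by exact_mod_cast hX0.ne'
  have hL := hasSum_integral_left (a := a) (γ := γ) hb hX0
  have hR := hasSum_integral_right (a := a) (b := b) hγ hX
  have hC := summable_crossTerm (γ := γ) hab hX
  -- A row sum is the correction to the `k`-th term on the right. A column sum is minus the
  -- correction to the `l`-th term on the left, as the two denominators are `b - a - k + l` and its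
  -- negative.
  have hrow : ∀ k : ℕ, HasSum (fun l : ℕ => crossTerm a b γ X (k, l))
      ((-1) ^ k * (poch a k / k !) * (X : ℂ) ^ (-a - k) *
        (Complex.Gamma (b - a - k) * Complex.Gamma γ * (Complex.Gamma (b - a - k + γ))⁻¹ -
          betaTail γ (1 / 2) (b - a - k))) := fun k => by
    have := (hasSum_betaTail hγ (δ := 1 / 2) (s := b - a - k) (by norm_num) (by norm_num)
      fun n hn => hab (n - k) (by push_cast; linear_combination -hn)).mul_left
        ((-1) ^ k * (poch a k / k !) * (X : ℂ) ^ (-a - k))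
    refine this.congr_fun fun l => ?_
    rw [crossTerm]
    ring
  have hcol : ∀ l : ℕ, HasSum (fun k : ℕ => crossTerm a b γ X (k, l))
      (-(poch (1 - γ) l / l ! * (X : ℂ) ^ (-(b + l)) *
        (Complex.Gamma (b + l) * Complex.Gamma (a - (b + l)) * (Complex.Gamma a)⁻¹ -
          betaHead (b + l) (X / 2) a))) := fun l => by
    have hbl : 0 < (b + l).re := by
      simp only [Complex.add_re, Complex.natCast_re]; positivity
    have := ((hasSum_betaHead hbl (ρ := X / 2) (a := a) (by linarith)
      fun n hn => hab (l - n) (by push_cast; linear_combination hn)).mul_left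
        (poch (1 - γ) l / l ! * (X : ℂ) ^ (-(b + l)))).neg
    refine this.congr_fun fun k => ?_
    have hne : a - (b + l) + k ≠ 0 := fun h => hab (l - k) (by push_cast; linear_combination h)
    have hne' : b - a - k + l ≠ 0 := fun h => hne (by linear_combination -h)
    have e1 : (((X / 2)⁻¹ : ℝ) : ℂ) ^ (a - (b + l) + k) =
        (X : ℂ) ^ (-(a - (b + l) + k)) * ((1 / 2 : ℝ) : ℂ) ^ (b - a - k + l) := by
      rw [show (X / 2)⁻¹ = X⁻¹ * (1 / 2 : ℝ)⁻¹ by rw [← mul_inv]; ring_nf, Complex.ofReal_mul,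
        Complex.mul_cpow_ofReal_nonneg (by positivity) (by positivity), Complex.ofReal_inv,
        Complex.ofReal_inv, Complex.inv_cpow, Complex.inv_cpow, ← Complex.cpow_neg,
        ← Complex.cpow_neg, show -(a - (b + l) + k) = b - a - k + l by ring]
      · rw [Complex.arg_ofReal_of_nonneg (by norm_num)]; exact Real.pi_pos.ne
      · rw [Complex.arg_ofReal_of_nonneg hX0.le]; exact Real.pi_pos.ne
    have e2 : (X : ℂ) ^ (-a - k) = (X : ℂ) ^ (-(b + l)) * (X : ℂ) ^ (-(a - (b + l) + k)) := by
      rw [← Complex.cpow_add _ _ hXc]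
      congr 1
      ring
    rw [e1, crossTerm]
    rw [e2, show a - (b + l) + k = -(b - a - k + l) by ring]
    field_simp
  -- By absolute convergence both orders of summation have the same total. It is added to the right
  -- half and subtracted from the left half, so the integral is unchanged while both incomplete
  -- integrals become Gamma quotients.
  have hS := hC.hasSum.prod_fiberwise hrow
  have hT := ((Equiv.prodComm ℕ ℕ).hasSum_iff.2 hC.hasSum).prod_fiberwise hcol
  refine ⟨_, _, (hR.add hS).congr_fun fun k => ?_, (hL.sub hT).congr_fun fun l => ?_, ?_⟩
  · ring
  · ring
  · rw [← intervalIntegral.integral_add_adjacent_intervals (b := 1 / 2)]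
    · ring
    · have hw := (Complex.betaIntegral_convergent hb hγ).mono_set (c := 0) (d := 1 / 2) (by
        rw [Set.uIcc_of_le (by norm_num), Set.uIcc_of_le zero_le_one]
        exact Set.Icc_subset_Icc_right (by norm_num))
      refine hw.mul_continuousOn fun t ht => ?_
      rw [Set.uIcc_of_le (by norm_num)] at ht
      have h := (continuousAt_one_add_cpow (-a) (mul_nonneg hX0.le ht.1)).comp
        (f := fun t : ℝ => X * t) (by fun_prop)
      simp only [Complex.ofReal_mul, Function.comp_def] at h
      exact h.continuousWithinAt
    · have hw := (Complex.betaIntegral_convergent hb hγ).mono_set (c := 1 / 2) (d := 1) (by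
        rw [Set.uIcc_of_le (by norm_num), Set.uIcc_of_le zero_le_one]
        exact Set.Icc_subset_Icc_left (by norm_num))
      refine hw.mul_continuousOn fun t ht => ?_
      rw [Set.uIcc_of_le (by norm_num)] at ht
      have h := (continuousAt_one_add_cpow (-a) (mul_nonneg hX0.le
        (show (0 : ℝ) ≤ t by linarith [ht.1]))).comp (f := fun t : ℝ => X * t) (by fun_prop)
      simp only [Complex.ofReal_mul, Function.comp_def] at h
      exact h.continuousWithinAt

end Split

theorem eulerIntegral_eq_connSum {a b c : ℂ} (hab : ∀ n : ℤ, a - b ≠ n) (hb : 0 < b.re)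
    (hc : b.re < c.re) {X : ℝ} (hX : 2 < X) :
    eulerIntegral b c (fun z => (1 - z) ^ (-a)) (-X) = connSum a b c (-X) := by
  have hX0 : 0 < X := by linarith
  have hXc : (X : ℂ) ≠ 0 := by exact_mod_cast hX0.ne'
  have hγ : 0 < (c - b).re := by simpa using hc
  obtain ⟨S, T, hS, hT, hI⟩ := integral_split hab hb hγ hX
  have hz : ‖(1 : ℂ) / -X‖ < 1 := by
    rw [norm_div, norm_neg, Complex.norm_real, norm_one, Real.norm_of_nonneg hX0.le,
      div_lt_one hX0]
    linarith
  have hb0 := re_ne_neg_natCast hb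
  have hGb := Complex.Gamma_ne_zero hb0
  have hGγ := Complex.Gamma_ne_zero_of_re_pos hγ
  have hab' : ∀ n : ℤ, b - a ≠ n := fun n hn => hab (-n) (by push_cast; linear_combination -hn)
  have hpa : ∀ n : ℕ, 1 - b + a ≠ -(n : ℂ) := fun n hn => hab (-n - 1) (by
    push_cast; linear_combination hn)
  have hpb : ∀ n : ℕ, 1 - a + b ≠ -(n : ℂ) := fun n hn => hab (n + 1) (by
    push_cast; linear_combination -hn)
  have h1 := ((isPowerSum_hyp (1 - c + a) a (1 - b + a)) _ hz).mul_left
    (connCoeff c b a * (X : ℂ) ^ (-a))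
  have h2 := ((isPowerSum_hyp (1 - c + b) b (1 - a + b)) _ hz).mul_left
    (connCoeff c a b * (X : ℂ) ^ (-b))
  have hS' := hS.mul_left (Complex.Gamma c / (Complex.Gamma b * Complex.Gamma (c - b)))
  have hT' := hT.mul_left (Complex.Gamma c / (Complex.Gamma b * Complex.Gamma (c - b)))
  have eS := h1.unique (hS'.congr_fun fun k => by
    have e1 : (X : ℂ) ^ (-a - k) = (X : ℂ) ^ (-a) / (X : ℂ) ^ k := by
      rw [Complex.cpow_sub _ _ hXc, Complex.cpow_natCast]
    have e2 : b - a - (k : ℂ) + (c - b) = c - a - k := by ring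
    have e3 : (1 / -(X : ℂ)) ^ k = (-1) ^ k / (X : ℂ) ^ k := by
      rw [one_div, neg_eq_neg_one_mul, mul_inv, mul_pow, inv_pow (X : ℂ)]; norm_num; rfl
    have h3 : ((-1 : ℂ) ^ k) * (-1) ^ k = 1 := by rw [← mul_pow]; simp
    have := poch_ne_zero hpa k
    rw [e1, e2, e3, Gamma_sub_nat hab', Gamma_inv_sub_nat, hyp, connCoeff, smul_eq_mul,
      show 1 - (b - a) = 1 - b + a by ring, show 1 - (c - a) = 1 - c + a by ring]
    have hf : ((k ! : ℕ) : ℂ) ≠ 0 := by exact_mod_cast k.factorial_ne_zero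
    rw [div_eq_mul_inv _ (Complex.Gamma b * Complex.Gamma (c - a)), mul_inv]
    generalize (Complex.Gamma (c - a))⁻¹ = g
    generalize (-1 : ℂ) ^ k = σ at h3 ⊢
    field_simp
    linear_combination (-(Complex.Gamma c * Complex.Gamma (b - a) * g * (X : ℂ) ^ (-a) * σ *
      poch (1 - c + a) k * poch a k)) * h3)
  have eT := h2.unique (hT'.congr_fun fun l => by
    have e1 : (X : ℂ) ^ (-(b + l)) = (X : ℂ) ^ (-b) / (X : ℂ) ^ l := by
      rw [neg_add', Complex.cpow_sub _ _ hXc, Complex.cpow_natCast]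
    have e3 : (1 / -(X : ℂ)) ^ l = (-1) ^ l / (X : ℂ) ^ l := by
      rw [one_div, neg_eq_neg_one_mul, mul_inv, mul_pow, inv_pow (X : ℂ)]; norm_num; rfl
    have := poch_ne_zero hpb l
    rw [e1, e3, ← sub_sub, Gamma_sub_nat hab, Gamma_add_nat hb0, hyp, connCoeff, smul_eq_mul,
      show 1 - (a - b) = 1 - a + b by ring, show 1 - (c - b) = 1 - c + b by ring]
    have hf : ((l ! : ℕ) : ℂ) ≠ 0 := by exact_mod_cast l.factorial_ne_zero
    rw [div_eq_mul_inv _ (Complex.Gamma a * Complex.Gamma (c - b)), mul_inv]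
    generalize (Complex.Gamma a)⁻¹ = g
    field_simp)
  rw [connSum, neg_neg, eS, eT, ← mul_add, ← hI, eulerIntegral]
  simp only [eulerWeight, smul_eq_mul]
  congr 2
  funext t
  rw [neg_mul, sub_neg_eq_add]

/-! ### The connection formula for the Gauss series: general parameters -/

/-- The part `|x| > 1` of the sector `|arg (-x)| < π`. -/
def outerRegion : Set ℂ := {x | 1 < ‖x‖ ∧ -x ∈ Complex.slitPlane}

theorem isOpen_outerRegion : IsOpen outerRegion :=
  (isOpen_lt continuous_const continuous_norm).inter
    (Complex.isOpen_slitPlane.preimage continuous_neg)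

theorem ne_zero_of_mem_outerRegion {x : ℂ} (hx : x ∈ outerRegion) : x ≠ 0 := by
  rintro rfl
  have := hx.1
  simp at this
  linarith

theorem norm_one_div_lt_one {x : ℂ} (hx : 1 < ‖x‖) : ‖1 / x‖ < 1 := by
  rw [norm_div, norm_one, div_lt_one (by linarith)]
  exact hx

theorem outerRegion_subset_cutPlane : outerRegion ⊆ cutPlane := by
  intro x hx
  rcases hx.2 with h | h
  · left
    simp only [Complex.neg_re, Complex.sub_re, Complex.one_re] at h ⊢
    linarith
  · right
    simpa using h

/-- The region is the image of the convex half-strip `Re w > 0`, `|Im w| < π` under `w ↦ -exp w`,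
with inverse `log (-x)`. -/
theorem isPreconnected_outerRegion : IsPreconnected outerRegion := by
  have hc : Convex ℝ {w : ℂ | 0 < w.re ∧ (-Real.pi < w.im ∧ w.im < Real.pi)} :=
    (convex_halfSpace_re_gt 0).inter
      ((convex_halfSpace_im_gt _).inter (convex_halfSpace_im_lt _))
  have h := hc.isPreconnected.image (fun w => -Complex.exp w) (by fun_prop)
  convert! h using 1
  ext x
  constructor
  · intro hx
    have hx0 : -x ≠ 0 := neg_ne_zero.2 (ne_zero_of_mem_outerRegion hx)
    refine ⟨Complex.log (-x), ⟨?_, ?_, ?_⟩, ?_⟩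
    · rw [Complex.log_re, norm_neg]; exact Real.log_pos hx.1
    · exact Complex.neg_pi_lt_log_im _
    · rw [Complex.log_im]
      exact lt_of_le_of_ne (Complex.arg_le_pi _) (Complex.mem_slitPlane_iff_arg.1 hx.2).1
    · simp only [Complex.exp_log hx0, neg_neg]
  · rintro ⟨w, ⟨h1, h2, h3⟩, rfl⟩
    refine ⟨?_, ?_⟩
    · rw [norm_neg, Complex.norm_exp]; exact Real.one_lt_exp_iff.2 h1
    · rw [neg_neg, Complex.mem_slitPlane_iff_arg]
      refine ⟨?_, Complex.exp_ne_zero _⟩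
      rw [Complex.arg_exp, (toIocMod_eq_self Real.two_pi_pos).2 ⟨h2, by linarith⟩]
      exact h3.ne

/-- The derivative of `(-x)^(-a) P(1/x)`. -/
theorem hasDerivAt_cpow_mul_comp {a x : ℂ} (hx : x ∈ outerRegion) {P : ℂ → ℂ}
    (hP : DifferentiableAt ℂ P (1 / x)) :
    HasDerivAt (fun x => (-x) ^ (-a) * P (1 / x))
      (x⁻¹ * ((-x) ^ (-a) * (-a * P (1 / x) - (1 / x) * deriv P (1 / x)))) x := by
  have hx0 := ne_zero_of_mem_outerRegion hx
  have h1 : HasDerivAt (fun x : ℂ => (-x) ^ (-a)) (-a * (-x) ^ (-a - 1) * -1) x :=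
    (hasDerivAt_neg x).cpow_const hx.2
  have h2 : HasDerivAt (fun x : ℂ => 1 / x) (-(x ^ 2)⁻¹) x := by
    simpa using hasDerivAt_inv hx0
  have h3 := h1.mul (hP.hasDerivAt.comp x h2)
  refine h3.congr_deriv ?_
  rw [Complex.cpow_sub _ _ (neg_ne_zero.2 hx0), Complex.cpow_one]
  simp only [Function.comp_apply]
  field_simp
  ring

theorem hasDerivAt_connSum {a b c x : ℂ} (hx : x ∈ outerRegion) :
    HasDerivAt (connSum a b c)
      (x⁻¹ * (connCoeff c b a * (-x) ^ (-a) *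
          (-a * ordinaryHypergeometric (1 - c + a) a (1 - b + a) (1 / x) -
            (1 / x) * deriv (ordinaryHypergeometric (1 - c + a) a (1 - b + a)) (1 / x)) +
        connCoeff c a b * (-x) ^ (-b) *
          (-b * ordinaryHypergeometric (1 - c + b) b (1 - a + b) (1 / x) -
            (1 / x) * deriv (ordinaryHypergeometric (1 - c + b) b (1 - a + b)) (1 / x)))) x := by
  have hz := norm_one_div_lt_one hx.1
  have h1 := (hasDerivAt_cpow_mul_comp (a := a) hx
    ((isPowerSum_hyp (1 - c + a) a (1 - b + a)).differentiableAt hz)).const_mul (connCoeff c b a)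
  have h2 := (hasDerivAt_cpow_mul_comp (a := b) hx
    ((isPowerSum_hyp (1 - c + b) b (1 - a + b)).differentiableAt hz)).const_mul (connCoeff c a b)
  refine ((h1.add h2).congr_deriv ?_).congr_of_eventuallyEq (Eventually.of_forall fun x => ?_)
  · ring
  · simp only [connSum, Pi.add_apply]
    ring

theorem differentiableOn_connSum (a b c : ℂ) : DifferentiableOn ℂ (connSum a b c) outerRegion :=
  fun _ hx => (hasDerivAt_connSum hx).differentiableAt.differentiableWithinAt

theorem eqOn_outerRegion {f g : ℂ → ℂ} (hf : DifferentiableOn ℂ f outerRegion)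
    (hg : DifferentiableOn ℂ g outerRegion) (h : ∀ X : ℝ, 2 < X → f (-X) = g (-X)) :
    Set.EqOn f g outerRegion := by
  have h4 : (-4 : ℂ) ∈ outerRegion := ⟨by norm_num, Or.inl (by norm_num)⟩
  refine (hf.analyticOnNhd isOpen_outerRegion).eqOn_of_preconnected_of_frequently_eq
    (hg.analyticOnNhd isOpen_outerRegion) isPreconnected_outerRegion h4 ?_
  -- The functions agree at the points `-(4 + t)`, `t > 0`, which accumulate at the interior point
  -- `-4`.
  have ht : Tendsto (fun t : ℝ => -((4 + t : ℝ) : ℂ)) (nhdsWithin 0 (Set.Ioi 0))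
      (nhdsWithin (-4) {(-4 : ℂ)}ᶜ) := by
    refine tendsto_nhdsWithin_iff.2 ⟨?_, ?_⟩
    · have : ContinuousAt (fun t : ℝ => -((4 + t : ℝ) : ℂ)) 0 := by fun_prop
      have h2 := this.tendsto.mono_left (nhdsWithin_le_nhds (s := Set.Ioi 0))
      simpa using h2
    · filter_upwards [self_mem_nhdsWithin] with t ht
      simp only [Set.mem_compl_iff, Set.mem_singleton_iff, neg_inj]
      intro h
      have : (4 + t : ℝ) = 4 := by exact_mod_cast h
      have h0 : 0 < t := ht
      linarith
  refine ht.frequently (Eventually.frequently ?_)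
  filter_upwards [self_mem_nhdsWithin] with t ht
  have h0 : 0 < t := ht
  exact h (4 + t) (by linarith)

/-- Validity of the connection formula for the continuation of the Gauss series. -/
def HasConnection (a b c : ℂ) : Prop :=
  ∀ f : ℂ → ℂ, DifferentiableOn ℂ f cutPlane → IsPowerSum (hyp a b c) f →
    ∀ x ∈ outerRegion, f x = connSum a b c x

theorem differentiableOn_one_sub_cpow (a : ℂ) :
    DifferentiableOn ℂ (fun z : ℂ => (1 - z) ^ (-a)) cutPlane := fun z hz => by
  have : DifferentiableAt ℂ (fun z : ℂ => (1 - z) ^ (-a)) z :=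
    DifferentiableAt.cpow_const (by fun_prop) hz
  exact this.differentiableWithinAt

theorem hyp_eq (a b c : ℂ) (n : ℕ) : hyp a b c n = (poch b n / poch c n) • (poch a n / n !) := by
  rw [hyp, smul_eq_mul, div_mul_div_comm, mul_comm (poch a n)]

theorem exists_continuation_hyp (a b : ℂ) {c : ℂ} (hc : ∀ n : ℕ, c ≠ -(n : ℂ)) :
    ∃ f : ℂ → ℂ, DifferentiableOn ℂ f cutPlane ∧ IsPowerSum (hyp a b c) f := by
  obtain ⟨f, hf, hs⟩ := hasMultiplier b hc _ _ (differentiableOn_one_sub_cpow a)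
    (isPowerSum_one_sub_cpow a)
  exact ⟨f, hf, fun z hz => (hs z hz).congr_fun fun n => by rw [hyp_eq]⟩

theorem hasConnection_of_re {a b c : ℂ} (hab : ∀ n : ℤ, a - b ≠ n) (hb : 0 < b.re)
    (hc : b.re < c.re) : HasConnection a b c := by
  intro f hf hs
  have hE := differentiableOn_eulerIntegral hb hc (differentiableOn_one_sub_cpow a)
  have hP := isPowerSum_eulerIntegral hb hc (isPowerSum_one_sub_cpow a)
  have heq := eqOn_cutPlane hf hE hs fun z hz => (hP z hz).congr_fun fun n => by rw [hyp_eq]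
  refine eqOn_outerRegion (hf.mono outerRegion_subset_cutPlane) (differentiableOn_connSum a b c)
    fun X hX => ?_
  rw [heq, eulerIntegral_eq_connSum hab hb hc hX]
  refine outerRegion_subset_cutPlane ⟨?_, ?_⟩
  · rw [norm_neg, Complex.norm_real, Real.norm_of_nonneg (by linarith)]; linarith
  · left; simp; linarith

/-! ### Contiguous relations lowering `c` -/

theorem connCoeff_succ_left {c : ℂ} (hc : c ≠ 0) (a b : ℂ) :
    connCoeff (c + 1) b a * (c - a) = c * connCoeff c b a := by
  have h1 := Complex.one_div_Gamma_eq_self_mul_one_div_Gamma_add_one (c - a)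
  rw [connCoeff, connCoeff, Complex.Gamma_add_one c hc, div_eq_mul_inv, div_eq_mul_inv, mul_inv,
    mul_inv, h1, show c - a + 1 = c + 1 - a by ring]
  ring

/-- Lowering `c` acts on each of the two solutions at infinity separately. -/
theorem hyp_lower_right {a c z : ℂ} (hc : c ≠ 0) (b : ℂ) (hz : ‖z‖ < 1) :
    connCoeff (c + 1) b a * ((c - a) * ordinaryHypergeometric (1 - (c + 1) + a) a (1 - b + a) z -
        z * deriv (ordinaryHypergeometric (1 - (c + 1) + a) a (1 - b + a)) z) =
      c * (connCoeff c b a * ordinaryHypergeometric (1 - c + a) a (1 - b + a) z) := by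
  have hp := isPowerSum_hyp (1 - (c + 1) + a) a (1 - b + a)
  have hq := isPowerSum_hyp (1 - c + a) a (1 - b + a)
  have h1 := (((hp.const_smul (c - a)).add (hp.euler.const_smul (-1))).const_smul
    (connCoeff (c + 1) b a)) z hz
  have h2 := (hq.const_smul (c * connCoeff c b a)) z hz
  have h3 := h1.unique (h2.congr_fun fun n => by
    simp only [smul_eq_mul]
    congr 1
    have e := poch_mul_shift (1 - (c + 1) + a) n
    have e2 := connCoeff_succ_left hc a b
    rw [show 1 - (c + 1) + a + 1 = 1 - c + a by ring] at e
    simp only [hyp]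
    linear_combination (poch a n / (poch (1 - b + a) n * n !)) *
      (poch (1 - c + a) n * e2 - connCoeff (c + 1) b a * e))
  simp only [smul_eq_mul] at h3
  linear_combination h3

/-- The operator `1 + c⁻¹ x d/dx` takes the Gauss function of `c + 1` to that of `c`. On `(-x)^(-a)
P(z)`, `z = 1 / x`, the operator `x d/dx` acts as `-a - z d/dz`, so the formula can be transported
on each solution at infinity separately. -/
theorem HasConnection.of_succ_right {a b c : ℂ} (hc : ∀ n : ℕ, c ≠ -(n : ℂ))
    (h : HasConnection a b (c + 1)) : HasConnection a b c := by
  intro f hf hs x hx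
  have hc0 : c ≠ 0 := by simpa using hc 0
  have hc1 : ∀ n : ℕ, c + 1 ≠ -(n : ℂ) := fun n hn => hc (n + 1) (by
      push_cast; linear_combination hn)
  obtain ⟨k, hk, hks⟩ := exists_continuation_hyp a b hc1
  have heq : Set.EqOn f (fun x => k x + c⁻¹ • (x • deriv k x)) cutPlane := by
    refine eqOn_cutPlane hf ?_ hs ?_
    · have hd := hk.deriv isOpen_cutPlane
      fun_prop
    · refine fun z hz => ((hks.add (hks.euler.const_smul c⁻¹)) z hz).congr_fun fun n => ?_
      congr 1
      have h1 := poch_mul_shift c n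
      have h2 := poch_ne_zero hc n
      have h3 := poch_ne_zero hc1 n
      have h4 : ((n ! : ℕ) : ℂ) ≠ 0 := by exact_mod_cast n.factorial_ne_zero
      simp only [hyp, smul_eq_mul]
      field_simp
      linear_combination -(poch a n * poch b n) * h1
  have hloc : k =ᶠ[nhds x] connSum a b (c + 1) := by
    filter_upwards [isOpen_outerRegion.mem_nhds hx] with w hw using h k hk hks w hw
  have hx0 := ne_zero_of_mem_outerRegion hx
  have hz := norm_one_div_lt_one hx.1
  rw [heq (outerRegion_subset_cutPlane hx)]
  beta_reduce
  rw [hloc.deriv_eq, hloc.eq_of_nhds, (hasDerivAt_connSum hx).deriv, smul_eq_mul, smul_eq_mul,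
    mul_inv_cancel_left₀ hx0, connSum, connSum, inv_mul_eq_div, ← eq_sub_iff_add_eq',
    div_eq_iff hc0]
  have e1 := hyp_lower_right (a := a) hc0 b hz
  have e2 := hyp_lower_right (a := b) hc0 a hz
  linear_combination (-x) ^ (-a) * e1 + (-x) ^ (-b) * e2

/-! ### Contiguous relations lowering `b` -/

theorem connCoeff_succ_middle {a b : ℂ} (hab : b - a ≠ 0) (c : ℂ) :
    connCoeff c (b + 1) a * b = connCoeff c b a * (b - a) := by
  have h1 := Complex.one_div_Gamma_eq_self_mul_one_div_Gamma_add_one b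
  rw [connCoeff, connCoeff, show b + 1 - a = b - a + 1 by ring, Complex.Gamma_add_one _ hab,
    div_eq_mul_inv, div_eq_mul_inv, mul_inv, mul_inv, h1]
  ring

theorem connCoeff_succ_right {a b : ℂ} (hab : a - b - 1 ≠ 0) (c : ℂ) :
    connCoeff c a (b + 1) * (a - b - 1) = (c - b - 1) * connCoeff c a b := by
  have h1 := Complex.one_div_Gamma_eq_self_mul_one_div_Gamma_add_one (c - (b + 1))
  have h2 := Complex.Gamma_add_one _ hab
  rw [sub_add_cancel] at h2
  rw [connCoeff, connCoeff, div_eq_mul_inv, div_eq_mul_inv, mul_inv, mul_inv, h1, h2,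
    show c - (b + 1) + 1 = c - b by ring, show a - (b + 1) = a - b - 1 by ring]
  ring

/-- Lowering `b` acts on the first solution at infinity. -/
theorem hyp_lower_first {a b c z : ℂ} (hab : ∀ n : ℤ, a - b ≠ n) (hz : ‖z‖ < 1) :
    connCoeff c (b + 1) a *
        ((1 - z) * deriv (ordinaryHypergeometric (1 - c + a) a (1 - (b + 1) + a)) z +
          (c - b - 1 - a) * ordinaryHypergeometric (1 - c + a) a (1 - (b + 1) + a) z) =
      (c - b - 1) * (connCoeff c b a * ordinaryHypergeometric (1 - c + a) a (1 - b + a) z) := by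
  have hp := isPowerSum_hyp (1 - c + a) a (1 - (b + 1) + a)
  have hq := isPowerSum_hyp (1 - c + a) a (1 - b + a)
  have h1 := (((hp.deriv.add (hp.euler.const_smul (-1))).add
    (hp.const_smul (c - b - 1 - a))).const_smul (connCoeff c (b + 1) a)) z hz
  have h2 := (hq.const_smul ((c - b - 1) * connCoeff c b a)) z hz
  have hb1 : ∀ n : ℕ, a - b ≠ -(n : ℂ) := fun n hn => hab (-n) (by push_cast; exact hn)
  have hb2 : ∀ n : ℕ, a - b + 1 ≠ -(n : ℂ) := fun n hn => hab (-n - 1) (by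
    push_cast; linear_combination hn)
  have h3 := h1.unique (h2.congr_fun fun n => by
    simp only [smul_eq_mul]
    congr 1
    have e := poch_mul_shift (a - b) n
    have e2 := connCoeff_succ_middle (a := a) (b := b) (fun h => hb1 0 (by simp; linear_combination -h)) c
    have n1 := poch_ne_zero hb1 n
    have n2 := poch_ne_zero hb2 n
    have n3 : a - b + n ≠ 0 := fun h => hb1 n (eq_neg_of_add_eq_zero_left h)
    have n4 : ((n ! : ℕ) : ℂ) ≠ 0 := by exact_mod_cast n.factorial_ne_zero
    have n5 : (n : ℂ) + 1 ≠ 0 := by exact_mod_cast n.succ_ne_zero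
    rw [hyp_succ]
    simp only [hyp]
    rw [show 1 - (b + 1) + a = a - b by ring, show 1 - b + a = a - b + 1 by ring]
    have e3 : poch (a - b + 1) n = poch (a - b) n * (a - b + n) / (a - b) := by
      rw [e, mul_div_cancel_left₀ _ (by simpa using hb1 0)]
    have n6 : a - b ≠ 0 := by simpa using hb1 0
    rw [e3]
    field_simp
    linear_combination (-(poch (1 - c + a) n * poch a n * (c - b - 1))) * e2)
  simp only [smul_eq_mul] at h3
  linear_combination h3

/-- Lowering `b` acts on the second solution at infinity. -/
theorem hyp_lower_second {a b c z : ℂ} (hab : ∀ n : ℤ, a - b ≠ n) (hz : ‖z‖ < 1) :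
    connCoeff c a (b + 1) *
        (z * (1 - z) * deriv (ordinaryHypergeometric (1 - c + (b + 1)) (b + 1) (1 - a + (b + 1))) z +
          ((c - 2 * b - 2) * z + (b + 1 - a)) *
            ordinaryHypergeometric (1 - c + (b + 1)) (b + 1) (1 - a + (b + 1)) z) =
      -((c - b - 1) * (connCoeff c a b * ordinaryHypergeometric (1 - c + b) b (1 - a + b) z)) := by
  have hp := isPowerSum_hyp (1 - c + (b + 1)) (b + 1) (1 - a + (b + 1))
  have hq := isPowerSum_hyp (1 - c + b) b (1 - a + b)
  have h1 := ((((hp.euler.add (hp.euler.id_smul.const_smul (-1))).add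
    (hp.id_smul.const_smul (c - 2 * b - 2))).add (hp.const_smul (b + 1 - a))).const_smul
      (connCoeff c a (b + 1))) z hz
  have h2 := (hq.const_smul (-((c - b - 1) * connCoeff c a b))) z hz
  have e2 := connCoeff_succ_right (a := a) (b := b) (fun h => hab 1 (by
    push_cast; linear_combination h)) c
  have hb1 : ∀ n : ℕ, 1 - a + b ≠ -(n : ℂ) := fun n hn => hab (n + 1) (by
    push_cast; linear_combination -hn)
  have hb2 : ∀ n : ℕ, 1 - a + b + 1 ≠ -(n : ℂ) := fun n hn => hab (n + 2) (by
    push_cast; linear_combination -hn)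
  have h3 := h1.unique (h2.congr_fun fun n => by
    simp only [smul_eq_mul]
    congr 1
    cases n with
    | zero =>
      simp only [shift, hyp, poch_zero]
      simp
      linear_combination -e2
    | succ n =>
      have n2 := poch_ne_zero hb2 n
      have n3 : 1 - a + b + 1 + n ≠ 0 := fun h => hb2 n (eq_neg_of_add_eq_zero_left h)
      have n4 : ((n ! : ℕ) : ℂ) ≠ 0 := by exact_mod_cast n.factorial_ne_zero
      have n5 : (n : ℂ) + 1 ≠ 0 := by exact_mod_cast n.succ_ne_zero
      have n6 : 1 - a + b ≠ 0 := by simpa using hb1 0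
      simp only [shift]
      rw [hyp_succ]
      simp only [hyp]
      rw [poch_succ_left (1 - c + b), poch_succ_left b, poch_succ_left (1 - a + b),
        Nat.factorial_succ, ← add_assoc, ← add_assoc]
      push_cast
      field_simp
      linear_combination (-(poch (1 - c + b + 1) n * poch (b + 1) n * b * (1 - c + b) *
        (1 - a + b + 1 + n))) * e2)
  simp only [smul_eq_mul] at h3
  linear_combination h3

/-- With `k` the Gauss function of `b + 1` and `f` that of `b`, one has `(c - b - 1) f = x (1 - x)
k' + (c - b - 1 - a x) k`. The factor on the left must be nonzero to recover `f`. -/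
theorem HasConnection.of_succ_middle {a b c : ℂ} (hab : ∀ n : ℤ, a - b ≠ n)
    (hc : ∀ n : ℕ, c ≠ -(n : ℂ)) (hbc : c - b - 1 ≠ 0) (h : HasConnection a (b + 1) c) :
    HasConnection a b c := by
  intro f hf hs x hx
  obtain ⟨k, hk, hks⟩ := exists_continuation_hyp a (b + 1) hc
  have heq : Set.EqOn (fun x => (c - b - 1) • f x) (fun x => x • deriv k x +
      (-1 : ℂ) • (x • (x • deriv k x)) + (c - b - 1) • k x + (-a) • (x • k x)) cutPlane := by
    have hd := hk.deriv isOpen_cutPlane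
    refine eqOn_cutPlane (hf.const_smul (c - b - 1)) ?_ (hs.const_smul (c - b - 1)) ?_
    · fun_prop
    · refine fun z hz => ((((hks.euler.add (hks.euler.id_smul.const_smul (-1))).add
        (hks.const_smul (c - b - 1))).add (hks.id_smul.const_smul (-a))) z hz).congr_fun
          fun n => ?_
      congr 1
      cases n with
      | zero => simp [shift, hyp]
      | succ n =>
        have n2 := poch_ne_zero hc n
        have n3 : c + n ≠ 0 := fun h => hc n (eq_neg_of_add_eq_zero_left h)
        have n4 : ((n ! : ℕ) : ℂ) ≠ 0 := by exact_mod_cast n.factorial_ne_zero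
        have n5 : (n : ℂ) + 1 ≠ 0 := by exact_mod_cast n.succ_ne_zero
        simp only [shift, smul_eq_mul]
        rw [hyp_succ a (b + 1) c]
        simp only [hyp]
        rw [poch_succ_left b, poch_succ, poch_succ, Nat.factorial_succ]
        push_cast
        field_simp
        ring
  have hloc : k =ᶠ[nhds x] connSum a (b + 1) c := by
    filter_upwards [isOpen_outerRegion.mem_nhds hx] with w hw using h k hk hks w hw
  have hx0 := ne_zero_of_mem_outerRegion hx
  have hz := norm_one_div_lt_one hx.1
  have hx1 := heq (outerRegion_subset_cutPlane hx)
  simp only [smul_eq_mul] at hx1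
  rw [hloc.deriv_eq, hloc.eq_of_nhds, (hasDerivAt_connSum hx).deriv,
    mul_inv_cancel_left₀ hx0] at hx1
  refine mul_left_cancel₀ hbc (hx1.trans ?_)
  have e1 := hyp_lower_first (c := c) hab hz
  have e2 := hyp_lower_second (c := c) hab hz
  have e3 : (-x) ^ (-b) = (-x) ^ (-(b + 1)) * (-x) := by
    rw [neg_add', Complex.cpow_sub _ _ (neg_ne_zero.2 hx0), Complex.cpow_one,
      div_mul_cancel₀ _ (neg_ne_zero.2 hx0)]
  rw [connSum, connSum, e3]
  have hxx : x * (1 / x) = 1 := mul_one_div_cancel hx0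
  generalize 1 / x = z at e1 e2 hxx ⊢
  generalize deriv (ordinaryHypergeometric (1 - c + a) a (1 - (b + 1) + a)) z = P at e1 e2 ⊢
  generalize deriv (ordinaryHypergeometric (1 - c + (b + 1)) (b + 1) (1 - a + (b + 1))) z = Q
    at e1 e2 ⊢
  generalize ordinaryHypergeometric (1 - c + (b + 1)) (b + 1) (1 - a + (b + 1)) z = q at e1 e2 ⊢
  linear_combination (-x) ^ (-a) * e1 + connCoeff c (b + 1) a * (-x) ^ (-a) * P * hxx +
    (-x) ^ (-(b + 1)) * x * e2 +
    connCoeff c a (b + 1) * (-x) ^ (-(b + 1)) * (z * Q - (c - 2 * b - 2) * q) * hxx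

/-- First raise `c` until `Re b + n < Re c`, with `n` such that `Re b + n > 0`; then raise `b` in
`n` steps. With `c` this far to the right, the factor `c - b - 1` never vanishes on the way. -/
theorem hasConnection {a b c : ℂ} (hab : ∀ n : ℤ, a - b ≠ n) (hc : ∀ n : ℕ, c ≠ -(n : ℂ)) :
    HasConnection a b c := by
  have shift_right : ∀ (n : ℕ) (b c : ℂ), (∀ n : ℤ, a - b ≠ n) → (∀ n : ℕ, c ≠ -(n : ℂ)) →
      0 < b.re + n → b.re + n < c.re → HasConnection a b c := by
    intro n
    induction n with
    | zero => intro b c hab _ hb hbc; exact hasConnection_of_re hab (by simpa using hb) (by simpa using hbc)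
    | succ n ih =>
      intro b c hab hc hb hbc
      push_cast at hb hbc
      refine HasConnection.of_succ_middle hab hc (fun h => ?_) (ih (b + 1) c (fun n hn => hab (n + 1) ?_)
        hc ?_ ?_)
      · have := congrArg Complex.re h
        simp at this
        have hk : (0 : ℝ) ≤ n := n.cast_nonneg
        linarith
      · push_cast; linear_combination hn
      · simp only [Complex.add_re, Complex.one_re]; linarith
      · simp only [Complex.add_re, Complex.one_re]; linarith
  obtain ⟨n, hn⟩ := exists_nat_gt (-b.re)
  have shift_left : ∀ (m : ℕ) (c : ℂ), (∀ n : ℕ, c ≠ -(n : ℂ)) → b.re + n < c.re + m →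
      HasConnection a b c := by
    intro m
    induction m with
    | zero => intro c hc hbc; exact shift_right n b c hab hc (by linarith) (by simpa using hbc)
    | succ m ih =>
      intro c hc hbc
      refine HasConnection.of_succ_right hc (ih (c + 1) (fun n hn => hc (n + 1) ?_) ?_)
      · push_cast; linear_combination hn
      · simp only [Complex.add_re, Complex.one_re]; push_cast at hbc; linarith
  obtain ⟨m, hm⟩ := exists_nat_gt (b.re + n - c.re)
  exact shift_left m c hc (by linarith)

/-! ### Double series with a shifted Pochhammer symbol -/

theorem hasSum_norm_poch {s r : ℝ} (hs : 0 ≤ s) (hr0 : 0 ≤ r) (hr : r < 1) :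
    HasSum (fun n : ℕ => ‖poch (s : ℂ) n‖ / n ! * r ^ n) ((1 - r) ^ (-s)) := by
  have h := isPowerSum_one_sub_cpow s r (by simpa [abs_of_nonneg hr0] using hr)
  rw [← Complex.hasSum_ofReal]
  convert! h using 1
  · funext n
    push_cast
    rw [norm_poch_ofReal hs, smul_eq_mul]
    ring
  · rw [Complex.ofReal_cpow (by linarith)]
    push_cast
    rfl

/-- The inner sum is `(1 - r)^(-s - j)`: a shift of the Pochhammer symbol by `j` costs a factor `(1
- r)^(-j)`, to be absorbed by the weights. -/
theorem summable_mul_norm_poch {s r : ℝ} (hs : 0 ≤ s) (hr0 : 0 ≤ r) (hr : r < 1) {w : ℕ → ℝ}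
    (hw0 : ∀ j, 0 ≤ w j) (hw : Summable fun j => w j * ((1 - r) ^ j)⁻¹) :
    Summable fun p : ℕ × ℕ => w p.1 * (‖poch ((s + p.1 : ℝ) : ℂ) p.2‖ / p.2 ! * r ^ p.2) := by
  have h := fun j : ℕ => (hasSum_norm_poch (s := s + j) (by positivity) hr0 hr).mul_left (w j)
  refine (summable_prod_of_nonneg fun p => ?_).2 ⟨fun j => (h j).summable, ?_⟩
  · have := hw0 p.1
    positivity
  · refine (hw.mul_left ((1 - r) ^ (-s))).congr fun j => ?_
    rw [(h j).tsum_eq, neg_add, Real.rpow_add (by linarith), Real.rpow_neg (by linarith) (j : ℝ),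
      Real.rpow_natCast]
    ring

/-! ### The double series of `Ψ₁` -/

theorem psiTerm_eq (a b c c' x y : ℂ) (p : ℕ × ℕ) :
    psiTerm a b c c' x y p = poch a p.2 / (poch c' p.2 * p.2 !) * y ^ p.2 *
      (x ^ p.1 • hyp (a + p.2) b c p.1) := by
  rw [psiTerm, hyp, add_comm p.1, poch_add, smul_eq_mul]
  simp only [div_eq_mul_inv, mul_inv]
  ring

/-- With `‖x‖ < ρ < 1`, `(b)ₘ xᵐ / (c)ₘ` is `O(ρᵐ)`. The sum over `m` then costs `(1 - ρ)^(-n)`, and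
the sum over `n` is a Kummer series at `y / (1 - ρ)`. -/
theorem summable_psiTerm (a b c c' : ℂ) {x : ℂ} (y : ℂ) (hx : ‖x‖ < 1) :
    Summable (psiTerm a b c c' x y) := by
  obtain ⟨ρ, h1, h2⟩ := exists_between hx
  have hρ : 0 < ρ := (norm_nonneg x).trans_lt h1
  obtain ⟨C, hC⟩ := (summable_poch_div_poch b c (z := x / ρ) (by
    rw [norm_div, Complex.norm_real, Real.norm_of_nonneg hρ.le, div_lt_one hρ]
    exact h1)).tendsto_atTop_zero.bddAbove_range
  have hC' : ∀ m, ‖poch b m / poch c m * x ^ m‖ ≤ C * ρ ^ m := fun m => by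
    have := hC ⟨m, rfl⟩
    beta_reduce at this
    rw [div_pow, mul_div_assoc', norm_div, norm_pow (ρ : ℂ), Complex.norm_real,
      Real.norm_of_nonneg hρ.le, div_le_iff₀ (by positivity)] at this
    exact this
  have hC0 : 0 ≤ C := by simpa using (norm_nonneg _).trans (hC' 0)
  have hk := (summable_kummer a c' (y / (1 - ρ : ℝ))).mul_left C
  have hs := summable_mul_norm_poch (s := ‖a‖) (norm_nonneg a) hρ.le h2
    (w := fun n => C * ‖poch a n / (poch c' n * n !) * y ^ n‖) (fun n => by positivity) (by
      refine hk.congr fun n => ?_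
      rw [div_pow, mul_div_assoc', norm_div, norm_pow ((1 - ρ : ℝ) : ℂ), Complex.norm_real,
        Real.norm_of_nonneg (by linarith), div_eq_mul_inv, mul_assoc])
  rw [← (Equiv.prodComm ℕ ℕ).summable_iff]
  refine Summable.of_norm_bounded hs fun p => ?_
  simp only [Function.comp_apply, Equiv.prodComm_apply, psiTerm_eq, Prod.fst_swap, Prod.snd_swap]
  have e1 : x ^ p.2 • hyp (a + p.1) b c p.2 =
      poch (a + p.1) p.2 / p.2 ! * (poch b p.2 / poch c p.2 * x ^ p.2) := by
    rw [hyp, smul_eq_mul]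
    simp only [div_eq_mul_inv, mul_inv]
    ring
  have e2 : ‖poch (a + p.1) p.2‖ ≤ ‖poch ((‖a‖ + p.1 : ℝ) : ℂ) p.2‖ :=
    norm_poch_le ((norm_add_le _ _).trans (by simp)) _
  have e3 : ‖poch (a + p.1) p.2 / p.2 ! * (poch b p.2 / poch c p.2 * x ^ p.2)‖ =
      ‖poch (a + p.1) p.2‖ / p.2 ! * ‖poch b p.2 / poch c p.2 * x ^ p.2‖ := by
    rw [norm_mul, norm_div, Complex.norm_natCast]
  rw [e1, norm_mul, e3]
  calc _ ≤ ‖poch a p.1 / (poch c' p.1 * p.1 !) * y ^ p.1‖ *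
        (‖poch ((‖a‖ + p.1 : ℝ) : ℂ) p.2‖ / p.2 ! * (C * ρ ^ p.2)) := by
        gcongr
        exact hC' p.2
    _ = _ := by ring

/-! ### The continuation in two variables -/

/-- The coefficient of `y ^ n` in `Ψ₁`, apart from the Gauss function. -/
noncomputable def kap (a c' : ℂ) (n : ℕ) : ℂ := poch a n / (poch c' n * n !)

/-- Absolutely summable sequences. -/
abbrev SeqSpace : Type := lp (fun _ : ℕ => ℂ) 1

/-- The `n`-th coordinate. -/
noncomputable def coord (n : ℕ) : SeqSpace →L[ℂ] ℂ := lp.evalCLM ℂ (fun _ : ℕ => ℂ) 1 n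

theorem coord_apply (n : ℕ) (v : SeqSpace) : coord n v = v n := rfl

theorem exists_seqSpace_entire {u : ℕ → ℂ} (hu : ∀ ρ : ℝ, Summable fun n => ‖u n‖ * |ρ| ^ n) :
    ∃ G : ℂ → SeqSpace, Differentiable ℂ G ∧ ∀ w n, G w n = u n * w ^ n := by
  have hsum : ∀ w : ℂ, Summable fun n : ℕ => (w ^ n * u n) • (lp.single 1 n (1 : ℂ) : SeqSpace) :=
    fun w => by
      refine Summable.of_norm_bounded (hu ‖w‖) fun n => ?_
      rw [norm_smul, lp.norm_single (by norm_num), norm_mul, norm_pow, norm_one, mul_one, abs_norm,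
        mul_comm]
  refine ⟨fun w => ∑' n : ℕ, (w ^ n * u n) • (lp.single 1 n (1 : ℂ) : SeqSpace), fun w => ?_,
    fun w n => ?_⟩
  · have h := Complex.differentiableOn_tsum_of_summable_norm (hu (‖w‖ + 1))
      (F := fun (n : ℕ) (w : ℂ) => (w ^ n * u n) • (lp.single 1 n (1 : ℂ) : SeqSpace))
      (U := Metric.ball 0 (‖w‖ + 1)) (fun n => by fun_prop) Metric.isOpen_ball fun n z hz => by
        rw [norm_smul, lp.norm_single (by norm_num), norm_mul, norm_pow, norm_one, mul_one,
          mul_comm]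
        have := (mem_ball_zero_iff.1 hz).le
        rw [abs_of_nonneg (by positivity)]
        gcongr
    exact h.differentiableAt (Metric.isOpen_ball.mem_nhds (by simp))
  · have h := (coord n).hasSum (hsum w).hasSum
    have h2 := h.unique (hasSum_single n fun m hm => by
      rw [map_smul, coord_apply, lp.single_apply_ne _ _ _ hm.symm, smul_zero])
    rw [map_smul, coord_apply, coord_apply, lp.single_apply_self, smul_eq_mul,
      mul_one] at h2
    rw [mul_comm]
    exact h2

variable {a b c c' : ℂ}

/-- The multiplier `(b)ₘ / (c)ₘ` does not depend on `n`, so it can be applied once to the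
`ℓ¹`-valued function with coordinates `kap n · Rⁿ · (1 - x)^(-(a + n))`. This yields locally uniform
control in `n` without estimating the individual `fₙ`. -/
theorem exists_seqSpace_continuation (hc : ∀ n : ℕ, c ≠ -(n : ℂ)) {f : ℕ → ℂ → ℂ}
    (hf : ∀ n, DifferentiableOn ℂ (f n) cutPlane)
    (hs : ∀ n : ℕ, IsPowerSum (hyp (a + n) b c) (f n)) (R : ℝ) :
    ∃ H : ℂ → SeqSpace, DifferentiableOn ℂ H cutPlane ∧
      ∀ x ∈ cutPlane, ∀ n, H x n = kap a c' n * (R : ℂ) ^ n * f n x := by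
  obtain ⟨G, hG, hGn⟩ := exists_seqSpace_entire (u := fun n => kap a c' n * (R : ℂ) ^ n)
    fun ρ => by
      refine (summable_kummer a c' (R * ρ)).congr fun n => ?_
      rw [mul_pow, kap, ← mul_assoc, norm_mul _ ((ρ : ℂ) ^ n), norm_pow (ρ : ℂ), Complex.norm_real,
        Real.norm_eq_abs]
  have hGd : DifferentiableOn ℂ (fun x : ℂ => (1 - x) ^ (-a) • G (1 - x)⁻¹) cutPlane := by
    refine (differentiableOn_one_sub_cpow a).smul (hG.comp_differentiableOn ?_)
    exact DifferentiableOn.inv (by fun_prop) fun x hx => Complex.slitPlane_ne_zero hx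
  obtain ⟨g, hg⟩ := exists_isPowerSum (hGd.mono ball_subset_cutPlane)
  obtain ⟨H, hH, hHs⟩ := hasMultiplier b hc _ _ hGd hg
  refine ⟨H, hH, fun x hx n => ?_⟩
  have h1 : (fun m => coord n (g m)) =
      fun m => (kap a c' n * (R : ℂ) ^ n) • (poch (a + n) m / m ! : ℂ) := by
    refine (hg.map (coord n)).coeff_unique
      ((isPowerSum_one_sub_cpow (a + n)).const_smul (kap a c' n * (R : ℂ) ^ n)) fun z hz => ?_
    have hz0 : 1 - z ≠ 0 := Complex.slitPlane_ne_zero (mem_cutPlane_of_norm_lt_one hz)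
    rw [map_smul, coord_apply, hGn, neg_add', Complex.cpow_sub _ _ hz0, Complex.cpow_natCast, smul_eq_mul,
      smul_eq_mul, inv_pow]
    ring
  have h2 := eqOn_cutPlane ((coord n).differentiable.comp_differentiableOn hH)
    ((hf n).const_smul (kap a c' n * (R : ℂ) ^ n)) (hHs.map (coord n)) fun z hz =>
      (((hs n).const_smul (kap a c' n * (R : ℂ) ^ n)) z hz).congr_fun fun m => by
        beta_reduce
        rw [map_smul, congrFun h1 m, hyp_eq, smul_comm (poch b m / poch c m)]
  exact h2 hx

theorem exists_isPowerSum_coord : ∃ W : ℂ → SeqSpace →L[ℂ] ℂ,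
    IsPowerSum coord W := by
  refine ⟨fun z => ∑' n : ℕ, z ^ n • coord n, fun z hz => ?_⟩
  refine (Summable.of_norm_bounded (summable_geometric_of_lt_one (norm_nonneg z) hz)
    fun n => ?_).hasSum
  have : ‖coord n‖ ≤ 1 :=
    ContinuousLinearMap.opNorm_le_bound _ zero_le_one fun v => by
      rw [one_mul]; exact lp.norm_apply_le_norm (by norm_num) v n
  rw [norm_smul, norm_pow]
  exact mul_le_of_le_one_right (by positivity) this

theorem psiDomain_eq : psiDomain = {p | p.1 ∈ cutPlane} := by
  ext p
  have hz : 1 - p.1 ≠ 0 ↔ p.1 ≠ 1 := by rw [sub_ne_zero, ne_comm]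
  simp only [psiDomain, cutPlane, Set.mem_ofPred_eq, Complex.mem_slitPlane_iff_arg, hz, abs_lt]
  constructor
  · rintro ⟨h1, h2, h3⟩
    exact ⟨h3.ne, h1⟩
  · rintro ⟨h1, h2⟩
    exact ⟨h2, Complex.neg_pi_lt_arg _, lt_of_le_of_ne (Complex.arg_le_pi _) h1⟩

theorem isPreconnected_psiDomain : IsPreconnected psiDomain := by
  have : psiDomain = cutPlane ×ˢ Set.univ := by rw [psiDomain_eq]; ext; simp
  rw [this]
  exact isPreconnected_cutPlane.prod isPreconnected_univ

theorem hasSum_and_analyticAt (hc : ∀ n : ℕ, c ≠ -(n : ℂ)) {f : ℕ → ℂ → ℂ}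
    (hf : ∀ n, DifferentiableOn ℂ (f n) cutPlane)
    (hs : ∀ n : ℕ, IsPowerSum (hyp (a + n) b c) (f n)) {x₀ : ℂ} (hx₀ : x₀ ∈ cutPlane) (y₀ : ℂ) :
    Summable (fun n => kap a c' n * y₀ ^ n * f n x₀) ∧
    AnalyticAt ℂ (fun p : ℂ × ℂ => ∑' n, kap a c' n * p.2 ^ n * f n p.1) (x₀, y₀) := by
  -- The weight `Rⁿ` is undone by the functional with coefficients `(y / R)ⁿ`, which is bounded on
  -- `ℓ¹` and analytic in `y` for `‖y‖ < R`, a neighbourhood of `y₀`.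
  set R : ℝ := ‖y₀‖ + 1 with hR
  have hR0 : 0 < R := by positivity
  have hRc : (R : ℂ) ≠ 0 := by exact_mod_cast hR0.ne'
  obtain ⟨H, hH, hHn⟩ := exists_seqSpace_continuation (c' := c') hc hf hs R
  obtain ⟨W, hW⟩ := exists_isPowerSum_coord
  have hlt : ∀ y : ℂ, ‖y‖ < R → ‖y / R‖ < 1 := fun y hy => by
    rw [norm_div, Complex.norm_real, Real.norm_of_nonneg hR0.le, div_lt_one hR0]
    exact hy
  have key : ∀ x ∈ cutPlane, ∀ y : ℂ, ‖y‖ < R →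
      HasSum (fun n => kap a c' n * y ^ n * f n x) (W (y / R) (H x)) := fun x hx y hy => by
    have h := (ContinuousLinearMap.apply ℂ ℂ (H x)).hasSum (hW (y / R) (hlt y hy))
    refine h.congr_fun fun n => ?_
    simp only [ContinuousLinearMap.apply_apply, smul_apply,
      coord_apply, hHn x hx n, smul_eq_mul, div_pow]
    field_simp
  have hy₀ : ‖y₀‖ < R := by rw [hR]; linarith
  refine ⟨(key x₀ hx₀ y₀ hy₀).summable, ?_⟩
  have hWd : DifferentiableOn ℂ W (Metric.ball 0 1) := fun z hz =>
    (hW.differentiableAt (mem_ball_zero_iff.1 hz)).differentiableWithinAt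
  have hWa : AnalyticAt ℂ W (y₀ / R) := hWd.analyticAt (Metric.isOpen_ball.mem_nhds (by
    rw [mem_ball_zero_iff]; exact hlt y₀ hy₀))
  have hHa : AnalyticAt ℂ H x₀ := hH.analyticAt (isOpen_cutPlane.mem_nhds hx₀)
  have h1 : AnalyticAt ℂ (fun p : ℂ × ℂ => W (p.2 / R)) (x₀, y₀) := by
    refine AnalyticAt.fun_comp (g := W) (f := fun p : ℂ × ℂ => p.2 / (R : ℂ)) hWa ?_
    exact analyticAt_snd.div analyticAt_const hRc
  have h2 : AnalyticAt ℂ (fun p : ℂ × ℂ => H p.1) (x₀, y₀) :=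
    AnalyticAt.fun_comp (g := H) (f := fun p : ℂ × ℂ => p.1) hHa analyticAt_fst
  have h3 : AnalyticAt ℂ (fun p : ℂ × ℂ => W (p.2 / R) (H p.1)) (x₀, y₀) := by
    have hb := (ContinuousLinearMap.apply ℂ ℂ (E := SeqSpace)).analyticAt_bilinear
      (H x₀, W (y₀ / R))
    exact AnalyticAt.comp₂ hb h2 h1
  refine h3.congr ?_
  have ho : IsOpen {p : ℂ × ℂ | p.1 ∈ cutPlane ∧ ‖p.2‖ < R} :=
    (isOpen_cutPlane.preimage continuous_fst).inter
      (isOpen_lt (f := fun p : ℂ × ℂ => ‖p.2‖) (by fun_prop) continuous_const)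
  filter_upwards [ho.mem_nhds (show (x₀, y₀) ∈ _ from ⟨hx₀, hy₀⟩)] with p hp
  exact (key p.1 hp.1 p.2 hp.2).tsum_eq.symm

theorem isContinuation_tsum (hc : ∀ n : ℕ, c ≠ -(n : ℂ)) {f : ℕ → ℂ → ℂ}
    (hf : ∀ n, DifferentiableOn ℂ (f n) cutPlane)
    (hs : ∀ n : ℕ, IsPowerSum (hyp (a + n) b c) (f n)) :
    IsContinuation a b c c' (fun p : ℂ × ℂ => ∑' n, kap a c' n * p.2 ^ n * f n p.1) where
  analytic := fun p hp => by
    rw [psiDomain_eq] at hp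
    exact (hasSum_and_analyticAt hc hf hs hp p.2).2
  hasSum := fun x y hx => by
    have h := ((Equiv.prodComm ℕ ℕ).summable_iff.2 (summable_psiTerm a b c c' y hx)).hasSum
    have h1 := h.prod_fiberwise (g := fun n => kap a c' n * y ^ n * f n x) fun n => by
      refine ((hs n x hx).mul_left (kap a c' n * y ^ n)).congr_fun fun m => ?_
      simp [psiTerm_eq, kap]
    simp only [Function.comp_apply, (Equiv.prodComm ℕ ℕ).tsum_eq] at h1
    have h2 := (summable_psiTerm a b c c' y hx).hasSum
    rwa [← h1.tsum_eq] at h2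

theorem isContinuation_Psi1 (b : ℂ) (hc : ∀ n : ℕ, c ≠ -(n : ℂ)) :
    IsContinuation a b c c' (fun p => Psi1 a b c c' p.1 p.2) := by
  choose f hf hs using fun n : ℕ => exists_continuation_hyp (a + n) b hc
  have h : ∃ F, IsContinuation a b c c' F := ⟨_, isContinuation_tsum hc hf hs⟩
  have e : (fun p : ℂ × ℂ => Psi1 a b c c' p.1 p.2) = h.choose := by
    funext p
    simp only [Psi1, dif_pos h]
  rw [e]
  exact h.choose_spec

/-- The continuation chosen in `Psi1` agrees with the explicit series near the origin, hence on the
connected domain. -/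
theorem hasSum_Psi1 (hc : ∀ n : ℕ, c ≠ -(n : ℂ)) {f : ℕ → ℂ → ℂ}
    (hf : ∀ n, DifferentiableOn ℂ (f n) cutPlane)
    (hs : ∀ n : ℕ, IsPowerSum (hyp (a + n) b c) (f n)) {x : ℂ} (hx : x ∈ cutPlane) (y : ℂ) :
    HasSum (fun n => kap a c' n * y ^ n * f n x) (Psi1 a b c c' x y) := by
  have h1 := isContinuation_Psi1 (a := a) (c' := c') b hc
  have h2 := isContinuation_tsum (c' := c') hc hf hs
  have h0 : ((0 : ℂ), (0 : ℂ)) ∈ psiDomain := by rw [psiDomain_eq]; exact zero_mem_cutPlane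
  have heq := h1.analytic.eqOn_of_preconnected_of_eventuallyEq h2.analytic isPreconnected_psiDomain
    h0 (by
      have ho : IsOpen {p : ℂ × ℂ | ‖p.1‖ < 1} := isOpen_lt (by fun_prop) continuous_const
      filter_upwards [ho.mem_nhds (show ((0 : ℂ), (0 : ℂ)) ∈ _ by simp)] with p hp
      exact (h1.hasSum p.1 p.2 hp).unique (h2.hasSum p.1 p.2 hp))
  have hm : (x, y) ∈ psiDomain := by rw [psiDomain_eq]; exact hx
  have h3 := heq hm
  simp only at h3
  rw [h3]
  exact (hasSum_and_analyticAt hc hf hs hx y).1.hasSum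

/-! ### The series `𝐔₁` and `𝐔₂` -/

/-- The terms of the double series behind the expansions in powers of `1 / x`. -/
noncomputable def expTerm (p q s z c' x y : ℂ) (i : ℕ × ℕ) : ℂ :=
  hyp p q s i.1 * (1 / x ^ i.1) * (poch (z - i.1) i.2 / poch c' i.2 * (y ^ i.2 / i.2 !))

theorem summable_expTerm (p q s z c' y : ℂ) {x : ℂ} (hx : 1 < ‖x‖) :
    Summable (expTerm p q s z c' x y) := by
  have hx0 : 0 < ‖x‖ := by linarith
  -- With `1 / ‖x‖ < t < 1`, the sum over the second index at radius `1 - t` costs `t^(-j)`, and the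
  -- Gauss series at `1 / (‖x‖ t) < 1` still converges.
  obtain ⟨t, ht1, ht2⟩ := exists_between ((inv_lt_one₀ hx0).2 hx)
  have ht0 : 0 < t := (inv_pos.2 hx0).trans ht1
  have hr0 : 0 < 1 - t := by linarith
  obtain ⟨C, hC⟩ := (summable_pow_div_poch c' (y / (1 - t : ℝ))).tendsto_atTop_zero.bddAbove_range
  have hC' : ∀ n, ‖y ^ n / poch c' n‖ ≤ C * (1 - t) ^ n := fun n => by
    have := hC ⟨n, rfl⟩
    beta_reduce at this
    rw [div_pow, div_right_comm, norm_div, norm_pow ((1 - t : ℝ) : ℂ), Complex.norm_real,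
      Real.norm_of_nonneg hr0.le, div_le_iff₀ (by positivity)] at this
    exact this
  have hC0 : 0 ≤ C := by simpa using (norm_nonneg _).trans (hC' 0)
  have hh := (summable_hyp p q s (z := ((‖x‖ * t)⁻¹ : ℝ)) (by
    rw [Complex.norm_real, Real.norm_of_nonneg (by positivity)]
    refine inv_lt_one_of_one_lt₀ ?_
    rw [inv_lt_iff_one_lt_mul₀ hx0] at ht1
    rwa [mul_comm])).mul_left C
  have hs := summable_mul_norm_poch (s := ‖z‖) (norm_nonneg z) hr0.le (by linarith)
    (w := fun j => C * (‖hyp p q s j‖ * (1 / ‖x‖ ^ j))) (fun n => by positivity) (by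
      refine hh.congr fun j => ?_
      rw [norm_mul, norm_pow, Complex.norm_real, Real.norm_of_nonneg (by positivity), inv_pow,
        mul_pow, sub_sub_cancel, mul_inv]
      ring)
  refine Summable.of_norm_bounded hs fun i => ?_
  have e2 : ‖poch (z - i.1) i.2‖ ≤ ‖poch ((‖z‖ + i.1 : ℝ) : ℂ) i.2‖ :=
    norm_poch_le ((norm_sub_le _ _).trans (by simp)) _
  have e3 : ‖expTerm p q s z c' x y i‖ = ‖hyp p q s i.1‖ * (1 / ‖x‖ ^ i.1) *
      (‖poch (z - i.1) i.2‖ / i.2 ! * ‖y ^ i.2 / poch c' i.2‖) := by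
    rw [expTerm]
    simp only [norm_mul, norm_div, norm_pow, norm_one, Complex.norm_natCast]
    ring
  rw [e3]
  calc _ ≤ ‖hyp p q s i.1‖ * (1 / ‖x‖ ^ i.1) *
        (‖poch ((‖z‖ + i.1 : ℝ) : ℂ) i.2‖ / i.2 ! * (C * (1 - t) ^ i.2)) := by
        gcongr
        exact hC' i.2
    _ = _ := by ring

theorem hasSum_kummer (a c y : ℂ) :
    HasSum (fun n : ℕ => poch a n / poch c n * (y ^ n / n !)) (kummer a c y) := by
  refine Summable.hasSum ((summable_kummer a c y).of_norm.congr fun n => ?_)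
  simp only [div_eq_mul_inv, mul_inv]
  ring

theorem hasSum_expTerm (p q s z c' y : ℂ) {x : ℂ} (hx : 1 < ‖x‖) :
    HasSum (fun j : ℕ => kummer (z - j) c' y * hyp p q s j * (1 / x ^ j))
      (∑' i, expTerm p q s z c' x y i) := by
  refine (summable_expTerm p q s z c' y hx).hasSum.prod_fiberwise fun j => ?_
  have := (hasSum_kummer (z - j) c' y).mul_left (hyp p q s j * (1 / x ^ j))
  convert! this using 1
  ring

/-- Summing the other index first, by `(a - b - j)ₙ / (1 - a + b)ⱼ = (a - b)ₙ / (1 - a - n + b)ⱼ`.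
-/
theorem hasSum_U2Term {a b : ℂ} (hab : ∀ n : ℤ, a - b ≠ n) (c c' y : ℂ) {x : ℂ}
    (hx : 1 < ‖x‖) : HasSum (U2Term a b c c' x y)
    (∑' i, expTerm (1 - c + b) b (1 - a + b) (a - b) c' x y i) := by
  have hS := (summable_expTerm (1 - c + b) b (1 - a + b) (a - b) c' y hx).hasSum
  refine ((Equiv.prodComm ℕ ℕ).hasSum_iff.2 hS).prod_fiberwise fun n => ?_
  have h1 := ((isPowerSum_hyp (1 - c + b) b (1 - a - n + b)) (1 / x)
    (norm_one_div_lt_one hx)).mul_left (poch (a - b) n / (n ! * poch c' n) * y ^ n)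
  rw [U2Term]
  convert! h1 using 1
  · funext j
    have hp1 : ∀ k : ℕ, 1 - a + b ≠ -(k : ℂ) := fun k hk => hab (k + 1) (by
      push_cast; linear_combination -hk)
    have hp2 : ∀ k : ℕ, 1 - a - n + b ≠ -(k : ℂ) := fun k hk => hab (k + 1 - n) (by
      push_cast; linear_combination -hk)
    have e := poch_mul_poch_one_sub (a - b) n j
    rw [show 1 - (a - b) = 1 - a + b by ring, show 1 - a + b - (n : ℂ) = 1 - a - n + b by ring] at e
    have n1 := poch_ne_zero hp1 j
    have n2 := poch_ne_zero hp2 j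
    have e2 : poch (a - b - j) n = poch (a - b) n * poch (1 - a + b) j / poch (1 - a - n + b) j := by
      rw [e, mul_div_cancel_right₀ _ n2]
    simp only [Function.comp_apply, Equiv.prodComm_apply, Prod.swap_prod_mk, expTerm, hyp,
      smul_eq_mul, e2, one_div, inv_pow]
    simp only [div_eq_mul_inv, mul_inv]
    field_simp
  · ring

theorem hasSum_U1Term (a b c c' y : ℂ) {x : ℂ} (hx : 1 < ‖x‖) : HasSum (U1Term a b c c' x y)
    (∑' i, expTerm (1 - c + a) a (1 - b + a) 0 c' x y i) := by
  have hS := (summable_expTerm (1 - c + a) a (1 - b + a) 0 c' y hx).hasSum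
  have hinj : Function.Injective (fun i : ℕ × ℕ => (i.1 + i.2, i.1)) := by
    rintro ⟨i, j⟩ ⟨k, l⟩ h
    simp only [Prod.mk.injEq] at h
    ext <;> simp <;> omega
  -- Here the Kummer series terminate: `(-k)ₙ = 0` for `k < n`. Only `k = n + j` remains, and `(-(n
  -- + j))ₙ = (-1)ⁿ (n + j)! / j!` then cancels the factorial in the Gauss coefficient.
  have hS' := (hinj.hasSum_iff (f := expTerm (1 - c + a) a (1 - b + a) 0 c' x y) (by
    rintro ⟨k, n⟩ hk
    have hlt : k < n := by
      by_contra hle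
      exact hk ⟨(n, k - n), by simp; omega⟩
    have h0 : poch (0 - (k : ℂ)) n = 0 := by
      obtain ⟨m, rfl⟩ := Nat.exists_eq_add_of_lt hlt
      rw [add_assoc, add_comm m 1, ← add_assoc, poch_add, poch_succ]
      ring
    simp only [expTerm, h0]
    simp)).2 hS
  refine hS'.prod_fiberwise fun n => ?_
  have h1 := ((isPowerSum_hyp (1 - c + a + n) (a + n) (1 - b + a + n)) (1 / x)
    (norm_one_div_lt_one hx)).mul_left (poch a n / (n ! * poch c' n) *
      (poch (1 - c + a) n / poch (1 - b + a) n) * (-(y / x)) ^ n)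
  rw [U1Term]
  convert! h1 using 1
  · funext j
    have hx0 : x ≠ 0 := fun h => by simp [h] at hx; linarith
    have e1 : poch (0 - ((n + j : ℕ) : ℂ)) n = (-1) ^ n * poch (1 + j) n := by
      rw [show (0 : ℂ) - ((n + j : ℕ) : ℂ) = -(j : ℂ) - n by push_cast; ring, poch_sub_self,
        sub_neg_eq_add]
    have e2 : (((n + j)! : ℕ) : ℂ) = j ! * poch (1 + j) n := by
      rw [← poch_one, ← poch_one, add_comm n j, poch_add]
    have hj : ∀ k : ℕ, 1 + (j : ℂ) ≠ -(k : ℂ) := fun k hk => by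
      have : ((1 + j + k : ℕ) : ℂ) = 0 := by push_cast; linear_combination hk
      norm_cast at this
      omega
    have n1 := poch_ne_zero hj n
    simp only [Function.comp_apply, expTerm, hyp, smul_eq_mul, e1, e2, poch_add, pow_add, one_div,
      inv_pow]
    rw [neg_eq_neg_one_mul (y / x), mul_pow, div_pow]
    simp only [div_eq_mul_inv, mul_inv]
    field_simp
  · ring

theorem summable_and_hasSum_U1 (a b c c' y : ℂ) {x : ℂ} (hx : 1 < ‖x‖) : Summable (U1Term a b c c' x y) ∧
    HasSum (U1Exp a b c c' x y) (U1 a b c c' x y) := by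
  have h := hasSum_U1Term a b c c' y hx
  refine ⟨h.summable, ?_⟩
  rw [U1, h.tsum_eq]
  refine (hasSum_expTerm (1 - c + a) a (1 - b + a) 0 c' y hx).congr_fun fun k => ?_
  rw [U1Exp, zero_sub, hyp, mul_comm (poch a k)]

theorem summable_and_hasSum_U2 {a b : ℂ} (hab : ∀ n : ℤ, a - b ≠ n) (c c' y : ℂ) {x : ℂ}
    (hx : 1 < ‖x‖) : Summable (U2Term a b c c' x y) ∧
    HasSum (U2Exp a b c c' x y) (U2 a b c c' x y) := by
  have h := hasSum_U2Term hab c c' y hx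
  refine ⟨h.summable, ?_⟩
  rw [U2, h.tsum_eq]
  exact hasSum_expTerm (1 - c + b) b (1 - a + b) (a - b) c' y hx

/-! ### The connection formula for `Ψ₁` -/

theorem mem_outerRegion {x : ℂ} (hx : 1 < ‖x‖) (hs : x ∈ sector) : x ∈ outerRegion :=
  ⟨hx, Complex.mem_slitPlane_iff_arg.2
    ⟨((le_abs_self _).trans_lt hs.2).ne, neg_ne_zero.2 hs.1⟩⟩

theorem connCoeff_mul_poch_first {a b : ℂ} (hab : ∀ n : ℤ, a - b ≠ n) (c : ℂ) (n : ℕ) :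
    connCoeff c b (a + n) =
      connCoeff c b a * (poch (1 - c + a) n / poch (1 - b + a) n) := by
  have hab' : ∀ n : ℤ, b - a ≠ n := fun n hn => hab (-n) (by push_cast; linear_combination -hn)
  have h3 : ((-1 : ℂ) ^ n) * (-1) ^ n = 1 := by rw [← mul_pow]; simp
  rw [connCoeff, connCoeff, ← sub_sub, ← sub_sub, Gamma_sub_nat hab',
    div_eq_mul_inv _ (Complex.Gamma b * Complex.Gamma (c - a - n)), mul_inv, Gamma_inv_sub_nat,
    show 1 - (b - a) = 1 - b + a by ring, show 1 - (c - a) = 1 - c + a by ring]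
  simp only [div_eq_mul_inv, mul_inv]
  linear_combination (Complex.Gamma c * Complex.Gamma (b - a) * (poch (1 - b + a) n)⁻¹ *
    (Complex.Gamma b)⁻¹ * poch (1 - c + a) n * (Complex.Gamma (c - a))⁻¹) * h3

/-- Kept in product form, since `(a)ₙ` may vanish; it is supplied by the coefficient `kap`. -/
theorem connCoeff_mul_poch_second {a b : ℂ} (hab : ∀ n : ℤ, a - b ≠ n) (c : ℂ) (n : ℕ) :
    connCoeff c (a + n) b * poch a n = connCoeff c a b * poch (a - b) n := by
  have h1 : ∀ k : ℕ, a - b ≠ -(k : ℂ) := fun k hk => hab (-k) (by push_cast; exact hk)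
  rw [connCoeff, connCoeff, show a + n - b = a - b + n by ring, Gamma_add_nat h1]
  simp only [div_eq_mul_inv, mul_inv]
  rw [Gamma_inv_eq_poch_mul a n]
  ring

theorem Psi1_eq {a b c : ℂ} (c' : ℂ) (hc : ∀ n : ℕ, c ≠ -(n : ℂ)) (hab : ∀ n : ℤ, a - b ≠ n)
    {x : ℂ} (y : ℂ) (hx : 1 < ‖x‖) (hs : x ∈ sector) :
    Psi1 a b c c' x y = connCoeff c b a * (-x) ^ (-a) * U1 a b c c' x y +
      connCoeff c a b * (-x) ^ (-b) * U2 a b c c' x y := by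
  choose f hf hfs using fun n : ℕ => exists_continuation_hyp (a + n) b hc
  have hxo := mem_outerRegion hx hs
  have h := hasSum_Psi1 (c' := c') hc hf hfs (outerRegion_subset_cutPlane hxo) y
  have h1 := (summable_and_hasSum_U1 a b c c' y hx).1.hasSum.mul_left
    (connCoeff c b a * (-x) ^ (-a))
  have h2 := (summable_and_hasSum_U2 hab c c' y hx).1.hasSum.mul_left
    (connCoeff c a b * (-x) ^ (-b))
  refine h.unique ((h1.add h2).congr_fun fun n => ?_)
  have habn : ∀ m : ℤ, a + n - b ≠ m := fun m hm => hab (m - n) (by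
    push_cast; linear_combination hm)
  rw [hasConnection habn hc (f n) (hf n) (hfs n) x hxo, connSum, connCoeff_mul_poch_first hab,
    U1Term, U2Term, kap]
  have e1 := connCoeff_mul_poch_second hab c n
  have hx0 : -x ≠ 0 := neg_ne_zero.2 hs.1
  have e2 : (-x) ^ (-(a + n)) = (-x) ^ (-a) * ((-x) ^ n)⁻¹ := by
    rw [neg_add', Complex.cpow_sub _ _ hx0, Complex.cpow_natCast, div_eq_mul_inv]
  have e3 : (-(y / x)) ^ n = y ^ n * ((-x) ^ n)⁻¹ := by
    rw [← div_neg, div_pow, div_eq_mul_inv]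
  rw [e2, e3, show 1 - (a + n) + b = 1 - a - n + b by ring,
    show 1 - c + (a + n) = 1 - c + a + n by ring, show 1 - b + (a + n) = 1 - b + a + n by ring]
  simp only [div_eq_mul_inv, mul_inv]
  linear_combination ((poch c' n)⁻¹ * (n ! : ℂ)⁻¹ * y ^ n * (-x) ^ (-b) *
    ordinaryHypergeometric (1 - c + b) b (1 - a - n + b) (1 * x⁻¹)) * e1

/-! ### Asymptotics -/

/-- Absolute convergence at `x = 2` gives the constant: for `‖x‖ ≥ 2` factor `‖x‖^(-M)` out of the
tail and replace the remaining powers of `‖x‖` by powers of `2`. -/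
theorem exists_tail_bound {u : ℕ → ℂ} {U : ℂ → ℂ}
    (h : ∀ x : ℂ, 1 < ‖x‖ → HasSum (fun k => u k * (1 / x ^ k)) (U x)) (M : ℕ) :
    ∃ C, 0 ≤ C ∧ ∀ x : ℂ, 2 ≤ ‖x‖ →
      ‖U x - ∑ k ∈ Finset.range M, u k * (1 / x ^ k)‖ ≤ C * (‖x‖ ^ M)⁻¹ := by
  have h2 : Summable fun k => ‖u k‖ * (1 / 2 ^ k) := by
    refine (h 2 (by norm_num)).summable.norm.congr fun k => ?_
    simp
  have h3 := ((summable_nat_add_iff M).2 h2).mul_right (2 ^ M)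
  refine ⟨∑' k, ‖u (k + M)‖ * (1 / 2 ^ (k + M)) * 2 ^ M, tsum_nonneg fun k => by positivity,
    fun x hx => ?_⟩
  have hx0 : 0 < ‖x‖ := by linarith
  have h4 := (hasSum_nat_add_iff' M).2 (h x (by linarith))
  refine h4.norm_le_of_bounded (h3.hasSum.mul_right (‖x‖ ^ M)⁻¹) fun k => ?_
  rw [norm_mul, norm_div, norm_one, norm_pow]
  have h5 : (2 : ℝ) ^ k ≤ ‖x‖ ^ k := by gcongr
  have e : ‖u (k + M)‖ * (1 / 2 ^ (k + M)) * 2 ^ M * (‖x‖ ^ M)⁻¹ =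
      ‖u (k + M)‖ * (1 / (2 ^ k * ‖x‖ ^ M)) := by
    rw [pow_add]
    field_simp
  rw [e, pow_add]
  gcongr

/-- The argument of `-x` is at most `π` in size, so the phase contributes a factor between `e^(-π
|Im a|)` and `e^(π |Im a|)`. This makes the estimates uniform up to the edges of the sector. -/
theorem norm_neg_cpow_le {x : ℂ} (hx : x ≠ 0) (a : ℂ) :
    ‖(-x) ^ (-a)‖ ≤ Real.exp (Real.pi * |a.im|) * ‖x‖ ^ (-a.re) := by
  rw [Complex.norm_cpow_of_ne_zero (neg_ne_zero.2 hx), norm_neg, Complex.neg_re, Complex.neg_im,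
    div_eq_mul_inv, ← Real.exp_neg, mul_comm]
  refine mul_le_mul_of_nonneg_right (Real.exp_le_exp.2 ?_) (by positivity)
  refine (le_abs_self _).trans ?_
  rw [mul_neg, neg_neg, abs_mul]
  exact mul_le_mul_of_nonneg_right (Complex.abs_arg_le_pi _) (abs_nonneg _)

theorem le_norm_neg_cpow {x : ℂ} (hx : x ≠ 0) (a : ℂ) :
    ‖x‖ ^ (-a.re) ≤ Real.exp (Real.pi * |a.im|) * ‖(-x) ^ (-a)‖ := by
  rw [Complex.norm_cpow_of_ne_zero (neg_ne_zero.2 hx), norm_neg, Complex.neg_re, Complex.neg_im,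
    div_eq_mul_inv, ← Real.exp_neg, mul_left_comm, ← Real.exp_add]
  refine le_mul_of_one_le_right (by positivity) (Real.one_le_exp_iff.2 ?_)
  have : -((-x).arg * a.im) ≤ Real.pi * |a.im| := by
    refine (neg_le_abs _).trans ?_
    rw [abs_mul]
    exact mul_le_mul_of_nonneg_right (Complex.abs_arg_le_pi _) (abs_nonneg _)
  linarith

theorem eventually_large (S : Set ℂ) (r : ℝ) :
    ∀ᶠ x in cobounded ℂ ⊓ 𝓟 S, r ≤ ‖x‖ ∧ x ∈ S := by
  refine Eventually.and ?_ ?_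
  · exact (eventually_cobounded_le_norm r).filter_mono inf_le_left
  · exact Filter.mem_inf_of_right (mem_principal_self S)

theorem isLittleO_norm_rpow {s t : ℝ} (hst : s < t) (l : Filter ℂ) (hl : l ≤ cobounded ℂ) :
    (fun x : ℂ => ‖x‖ ^ s) =o[l] (fun x : ℂ => ‖x‖ ^ t) := by
  have h : (fun x : ℝ => x ^ s) =o[atTop] (fun x : ℝ => x ^ t) := by
    refine (isLittleO_iff_tendsto' ?_).2 ?_
    · filter_upwards [eventually_gt_atTop 0] with x hx h0
      exact absurd h0 (Real.rpow_pos_of_pos hx t).ne'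
    · refine (tendsto_rpow_neg_atTop (sub_pos.2 hst)).congr' ?_
      filter_upwards [eventually_gt_atTop 0] with x hx
      rw [← Real.rpow_sub hx, neg_sub]
  exact (h.comp_tendsto tendsto_norm_cobounded_atTop).mono hl

theorem Psi1_expansion (hc : ∀ n : ℕ, c ≠ -(n : ℂ)) (hab : ∀ n : ℤ, a - b ≠ n) (y : ℂ) (M N : ℕ) :
    (fun x : ℂ => Psi1 a b c c' x y -
        (connCoeff c b a * (-x) ^ (-a) * ∑ k ∈ Finset.range M, U1Exp a b c c' x y k +
          connCoeff c a b * (-x) ^ (-b) * ∑ l ∈ Finset.range N, U2Exp a b c c' x y l))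
        =O[cobounded ℂ ⊓ 𝓟 sector]
      (fun x : ℂ => ‖connCoeff c b a‖ * ‖x‖ ^ (-a.re - M) +
        ‖connCoeff c a b‖ * ‖x‖ ^ (-b.re - N)) := by
  obtain ⟨C₁, hC₁, h₁⟩ := exists_tail_bound (U := fun x => U1 a b c c' x y)
    (fun x hx => (summable_and_hasSum_U1 a b c c' y hx).2) M
  obtain ⟨C₂, hC₂, h₂⟩ := exists_tail_bound (U := fun x => U2 a b c c' x y)
    (fun x hx => (summable_and_hasSum_U2 hab c c' y hx).2) N
  set E₁ := Real.exp (Real.pi * |a.im|)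
  set E₂ := Real.exp (Real.pi * |b.im|)
  refine IsBigO.of_bound (E₁ * C₁ + E₂ * C₂) ?_
  filter_upwards [eventually_large sector 2] with x hx
  have hx0 : 0 < ‖x‖ := by linarith [hx.1]
  rw [Psi1_eq c' hc hab y (by linarith [hx.1]) hx.2, Real.norm_of_nonneg (by positivity)]
  have k₁ := h₁ x hx.1
  have k₂ := h₂ x hx.1
  have p₁ := norm_neg_cpow_le hx.2.1 a
  have p₂ := norm_neg_cpow_le hx.2.1 b
  have r : ∀ (s : ℝ) (n : ℕ), ‖x‖ ^ (s - n) = ‖x‖ ^ s * (‖x‖ ^ n)⁻¹ := fun s n => by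
    rw [Real.rpow_sub hx0, Real.rpow_natCast, div_eq_mul_inv]
  calc _ = ‖connCoeff c b a * (-x) ^ (-a) *
          (U1 a b c c' x y - ∑ k ∈ Finset.range M, U1Exp a b c c' x y k) +
        connCoeff c a b * (-x) ^ (-b) *
          (U2 a b c c' x y - ∑ l ∈ Finset.range N, U2Exp a b c c' x y l)‖ := by
        congr 1; ring
    _ ≤ ‖connCoeff c b a‖ * (E₁ * ‖x‖ ^ (-a.re)) * (C₁ * (‖x‖ ^ M)⁻¹) +
        ‖connCoeff c a b‖ * (E₂ * ‖x‖ ^ (-b.re)) * (C₂ * (‖x‖ ^ N)⁻¹) := by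
        refine (norm_add_le _ _).trans ?_
        simp only [norm_mul]
        gcongr
        · exact k₁
        · exact k₂
    _ = E₁ * C₁ * (‖connCoeff c b a‖ * ‖x‖ ^ (-a.re - M)) +
        E₂ * C₂ * (‖connCoeff c a b‖ * ‖x‖ ^ (-b.re - N)) := by rw [r, r]; ring
    _ ≤ _ := by
        have q₁ : 0 ≤ ‖connCoeff c b a‖ * ‖x‖ ^ (-a.re - M) := by positivity
        have q₂ : 0 ≤ ‖connCoeff c a b‖ * ‖x‖ ^ (-b.re - N) := by positivity
        have q₃ : 0 ≤ E₁ * C₁ := by positivity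
        have q₄ : 0 ≤ E₂ * C₂ := by positivity
        nlinarith [mul_nonneg q₃ q₂, mul_nonneg q₄ q₁]

/-! ### The leading approximation and its dominance -/

theorem kummer_zero (c y : ℂ) : kummer 0 c y = 1 := by
  refine (hasSum_kummer 0 c y).unique ?_
  convert! hasSum_single (f := fun n : ℕ => poch 0 n / poch c n * (y ^ n / n !)) 0 fun n hn => ?_
  · simp
  · obtain ⟨m, rfl⟩ := Nat.exists_eq_succ_of_ne_zero hn
    simp [poch_succ_left]

/-- The error of the leading approximation. -/
noncomputable def leadingError (a b c x : ℂ) : ℝ :=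
  ‖connCoeff c b a‖ * ‖x‖ ^ (-a.re - 1) + ‖connCoeff c a b‖ * ‖x‖ ^ (-b.re - 1)

theorem Psi1_sub_leading (hc : ∀ n : ℕ, c ≠ -(n : ℂ)) (hab : ∀ n : ℤ, a - b ≠ n) (y : ℂ) :
    (fun x : ℂ => Psi1 a b c c' x y - leading a b c c' x y)
      =O[cobounded ℂ ⊓ 𝓟 sector] leadingError a b c := by
  refine (Psi1_expansion (c' := c') hc hab y 1 1).congr (fun x => ?_) fun x => ?_
  · simp [leading, U1Exp, U2Exp, kummer_zero]
  · simp [leadingError]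

theorem Psi1_isEquivalent (hc : ∀ n : ℕ, c ≠ -(n : ℂ)) (hab : ∀ n : ℤ, a - b ≠ n) (y : ℂ)
    {S : Set ℂ} (hS : S ⊆ sector) (h : leadingError a b c =o[cobounded ℂ ⊓ 𝓟 S]
      (fun x : ℂ => leading a b c c' x y)) :
    (fun x : ℂ => Psi1 a b c c' x y) ~[cobounded ℂ ⊓ 𝓟 S] (fun x => leading a b c c' x y) :=
  ((Psi1_sub_leading hc hab y).mono (inf_le_inf_left _ (principal_mono.2 hS))).trans_isLittleO h

theorem neg_cpow_isBigO (a : ℂ) :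
    (fun x : ℂ => (-x) ^ (-a)) =O[cobounded ℂ ⊓ 𝓟 sector] (fun x : ℂ => ‖x‖ ^ (-a.re)) := by
  refine IsBigO.of_bound (Real.exp (Real.pi * |a.im|)) ?_
  filter_upwards [eventually_large sector 1] with x hx
  rw [Real.norm_of_nonneg (by positivity)]
  exact norm_neg_cpow_le hx.2.1 a

theorem isBigO_const_mul_neg_cpow (a : ℂ) {k : ℂ} (hk : k ≠ 0) :
    (fun x : ℂ => ‖x‖ ^ (-a.re)) =O[cobounded ℂ ⊓ 𝓟 sector] (fun x : ℂ => k * (-x) ^ (-a)) := by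
  refine (isBigO_const_mul_right_iff hk).2 (IsBigO.of_bound (Real.exp (Real.pi * |a.im|)) ?_)
  filter_upwards [eventually_large sector 1] with x hx
  rw [Real.norm_of_nonneg (by positivity)]
  exact le_norm_neg_cpow hx.2.1 a

/-- If the coefficient of `(-x)^(-a)` does not vanish and `(-x)^(-b)` is of lower order or absent,
then `‖x‖^(-Re a)` is dominated by the sum. -/
theorem isBigO_sum_neg_cpow {a b : ℂ} {k m : ℂ} (hk : k ≠ 0) (h : a.re < b.re ∨ m = 0) :
    (fun x : ℂ => ‖x‖ ^ (-a.re)) =O[cobounded ℂ ⊓ 𝓟 sector]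
      (fun x : ℂ => k * (-x) ^ (-a) + m * (-x) ^ (-b)) := by
  have h1 := isBigO_const_mul_neg_cpow a hk
  rcases h with h | rfl
  · have h2 : (fun x : ℂ => m * (-x) ^ (-b)) =o[cobounded ℂ ⊓ 𝓟 sector]
        (fun x : ℂ => k * (-x) ^ (-a)) :=
      (((neg_cpow_isBigO b).const_mul_left m).trans_isLittleO
        (isLittleO_norm_rpow (by linarith) _ inf_le_left)).trans_isBigO h1
    exact (h1.trans h2.right_isBigO_add).congr_right fun x => add_comm _ _
  · simpa using h1

theorem leadingError_isLittleO {t : ℝ} (h1 : connCoeff c b a = 0 ∨ -a.re - 1 < t)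
    (h2 : connCoeff c a b = 0 ∨ -b.re - 1 < t) :
    leadingError a b c =o[cobounded ℂ ⊓ 𝓟 sector] (fun x : ℂ => ‖x‖ ^ t) := by
  have key : ∀ (k s : ℝ), k = 0 ∨ s < t →
      (fun x : ℂ => k * ‖x‖ ^ s) =o[cobounded ℂ ⊓ 𝓟 sector] (fun x : ℂ => ‖x‖ ^ t) := by
    rintro k s (rfl | h)
    · simp
    · exact (isLittleO_norm_rpow h _ inf_le_left).const_mul_left k
  exact (key _ _ (h1.imp_left fun h => by simp [h])).add (key _ _ (h2.imp_left fun h => by simp [h]))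

theorem Psi1_isEquivalent_of_dominant (hc : ∀ n : ℕ, c ≠ -(n : ℂ)) (hab : ∀ n : ℤ, a - b ≠ n) (y : ℂ)
    (h : (a.re < b.re ∧ connCoeff c b a ≠ 0) ∨
      (b.re < a.re ∧ connCoeff c a b * kummer (a - b) c' y ≠ 0) ∨
      (connCoeff c a b = 0 ∧ connCoeff c b a ≠ 0) ∨
      (connCoeff c b a = 0 ∧ connCoeff c a b * kummer (a - b) c' y ≠ 0)) :
    (fun x : ℂ => Psi1 a b c c' x y) ~[cobounded ℂ ⊓ 𝓟 sector]
      (fun x : ℂ => leading a b c c' x y) := by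
  refine Psi1_isEquivalent hc hab y subset_rfl ?_
  -- The first leading term is of exact order `‖x‖^(-Re a)`, and the second is of lower order or
  -- absent. Each part of the error either has a zero coefficient or an exponent below `-Re a`. The
  -- next claim is the same with the two solutions exchanged.
  have hA : (a.re < b.re ∨ connCoeff c a b = 0) → connCoeff c b a ≠ 0 →
      leadingError a b c =o[cobounded ℂ ⊓ 𝓟 sector] (fun x : ℂ => leading a b c c' x y) := by
    intro h1 h2
    have hO := isBigO_sum_neg_cpow (a := a) (b := b) (m := connCoeff c a b * kummer (a - b) c' y) h2
      (h1.imp_right fun h => by simp [h])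
    refine (leadingError_isLittleO (t := -a.re) (Or.inr (by linarith)) ?_).trans_isBigO
      (hO.congr_right fun x => ?_)
    · rcases h1 with h1 | h1
      · right; linarith
      · exact Or.inl h1
    · rw [leading]; ring
  have hB : (b.re < a.re ∨ connCoeff c b a = 0) → connCoeff c a b * kummer (a - b) c' y ≠ 0 →
      leadingError a b c =o[cobounded ℂ ⊓ 𝓟 sector] (fun x : ℂ => leading a b c c' x y) := by
    intro h1 h2
    have hO := isBigO_sum_neg_cpow (a := b) (b := a) (m := connCoeff c b a) h2 h1
    refine (leadingError_isLittleO (t := -b.re) ?_ (Or.inr (by linarith))).trans_isBigO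
      (hO.congr_right fun x => ?_)
    · rcases h1 with h1 | h1
      · right; linarith
      · exact Or.inl h1
    · rw [leading]; ring
  rcases h with ⟨h1, h2⟩ | ⟨h1, h2⟩ | ⟨h1, h2⟩ | ⟨h1, h2⟩
  · exact hA (Or.inl h1) h2
  · exact hB (Or.inl h1) h2
  · exact hA (Or.inr h1) h2
  · exact hB (Or.inr h1) h2

end Humbert

theorem mainTheorem9 (a b c c' : ℂ)
    (hc : ∀ n : ℕ, c ≠ -(n : ℂ)) (hc' : ∀ n : ℕ, c' ≠ -(n : ℂ))
    (hab : ∀ n : ℤ, a - b ≠ (n : ℂ)) :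
    -- `Ψ₁` is the analytic continuation of its double series
    Humbert.IsContinuation a b c c' (fun p => Humbert.Psi1 a b c c' p.1 p.2) ∧
    -- convergence of `𝐔₁`, `𝐔₂` and their expansions in powers of `1 / x`
    (∀ x y : ℂ, 1 < ‖x‖ →
      Summable (Humbert.U1Term a b c c' x y) ∧
      Summable (Humbert.U2Term a b c c' x y) ∧
      HasSum (Humbert.U1Exp a b c c' x y) (Humbert.U1 a b c c' x y) ∧
      HasSum (Humbert.U2Exp a b c c' x y) (Humbert.U2 a b c c' x y)) ∧
    -- connection formula
    (∀ x y : ℂ, 1 < ‖x‖ → x ∈ Humbert.sector →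
      Humbert.Psi1 a b c c' x y =
        Humbert.connCoeff c b a * (-x) ^ (-a) * Humbert.U1 a b c c' x y +
        Humbert.connCoeff c a b * (-x) ^ (-b) * Humbert.U2 a b c c' x y) ∧
    -- the complete asymptotic expansion as `|x| → ∞` in the sector
    (∀ (y : ℂ) (M N : ℕ),
      (fun x : ℂ => Humbert.Psi1 a b c c' x y -
        (Humbert.connCoeff c b a * (-x) ^ (-a) *
            ∑ k ∈ Finset.range M, Humbert.U1Exp a b c c' x y k +
          Humbert.connCoeff c a b * (-x) ^ (-b) *
            ∑ l ∈ Finset.range N, Humbert.U2Exp a b c c' x y l))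
        =O[cobounded ℂ ⊓ 𝓟 Humbert.sector]
      (fun x : ℂ => ‖Humbert.connCoeff c b a‖ * ‖x‖ ^ (-a.re - M) +
        ‖Humbert.connCoeff c a b‖ * ‖x‖ ^ (-b.re - N))) ∧
    -- the leading approximation, with the error of each of its two parts
    (∀ y : ℂ,
      (fun x : ℂ => Humbert.Psi1 a b c c' x y - Humbert.leading a b c c' x y)
        =O[cobounded ℂ ⊓ 𝓟 Humbert.sector]
      (fun x : ℂ => ‖Humbert.connCoeff c b a‖ * ‖x‖ ^ (-a.re - 1) +
        ‖Humbert.connCoeff c a b‖ * ‖x‖ ^ (-b.re - 1))) ∧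
    -- the quotient tends to `1` wherever the two leading terms do not cancel up to the error
    (∀ (y : ℂ) (S : Set ℂ), S ⊆ Humbert.sector →
      (fun x : ℂ => ‖Humbert.connCoeff c b a‖ * ‖x‖ ^ (-a.re - 1) +
        ‖Humbert.connCoeff c a b‖ * ‖x‖ ^ (-b.re - 1))
        =o[cobounded ℂ ⊓ 𝓟 S] (fun x : ℂ => Humbert.leading a b c c' x y) →
      (fun x : ℂ => Humbert.Psi1 a b c c' x y)
        ~[cobounded ℂ ⊓ 𝓟 S] (fun x : ℂ => Humbert.leading a b c c' x y)) ∧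
    -- in particular in the whole sector, if one leading term dominates the other
    (∀ y : ℂ,
      (a.re < b.re ∧ Humbert.connCoeff c b a ≠ 0) ∨
      (b.re < a.re ∧ Humbert.connCoeff c a b * Humbert.kummer (a - b) c' y ≠ 0) ∨
      (Humbert.connCoeff c a b = 0 ∧ Humbert.connCoeff c b a ≠ 0) ∨
      (Humbert.connCoeff c b a = 0 ∧
        Humbert.connCoeff c a b * Humbert.kummer (a - b) c' y ≠ 0) →
      (fun x : ℂ => Humbert.Psi1 a b c c' x y)
        ~[cobounded ℂ ⊓ 𝓟 Humbert.sector] (fun x : ℂ => Humbert.leading a b c c' x y)) := by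
  exact ⟨Humbert.isContinuation_Psi1 b hc,
    fun x y hx => ⟨(Humbert.summable_and_hasSum_U1 a b c c' y hx).1,
      (Humbert.summable_and_hasSum_U2 hab c c' y hx).1,
      (Humbert.summable_and_hasSum_U1 a b c c' y hx).2,
      (Humbert.summable_and_hasSum_U2 hab c c' y hx).2⟩,
    fun x y hx hs => Humbert.Psi1_eq c' hc hab y hx hs,
    fun y M N => Humbert.Psi1_expansion hc hab y M N,
    fun y => Humbert.Psi1_sub_leading hc hab y,
    fun y S hS h => Humbert.Psi1_isEquivalent hc hab y hS h,
    fun y h => Humbert.Psi1_isEquivalent_of_dominant hc hab y h⟩
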